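/- **Proposition 1.1.** Let $M$ be a complex manifold of dimension $n$, $\pi:E\to M$ a holomorphic vector bundle of rank $m$, and $(E,[\cdot,\cdot]_E,\rho)$ a holomorphic Lie algebroid: $\rho:E\to T'M$ is a holomorphic bundle morphism and $[\cdot,\cdot]_E$ a Lie bracket on (local) holomorphic sections of $E$ with $[s_1,fs_2]_E=f[s_1,s_2]_E+\rho(s_1)(f)s_2$ for holomorphic $f$. The *complexified prolongation* $\mathcal T_{\mathbb C}E$ has as fibre over $u\in E$ the space of pairs $(e,v)\in (E_{\pi(u)})_{\mathbb C}\times T_{\mathbb C,u}E$ with $\rho_{\mathbb C}(e)=\pi_{*,\mathbb C}(v)$, where $\rho_{\mathbb C}$ and $\pi_{*,\mathbb C}$ are the $\mathbb C$-linear extensions of $\rho$ and $\pi_*$ to the complexifications $E_{\mathbb C}=E'\oplus E''$ and $T_{\mathbb C}E=T'E\oplus T''E$. Its bracket $[\cdot,\cdot]_{\mathcal T}$ is the $\mathbb C$-bilinear extension of the bracket on real smooth sections $(s,X)$ (where $s$ is a smooth section of $\pi^*E$ and $X$ a smooth vector field on the real manifold $E$ with $\pi_*X=\rho(s)$) determined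 by $[(\sigma\circ\pi,X),(\tau\circ\pi,Y)]=([\sigma,\tau]_E\circ\pi,[X,Y])$ for local holomorphic sections $\sigma,\tau$ of $E$, together with skew-symmetry and the Leibniz rule $[Z,fW]=f[Z,W]+X(f)W$ for $Z=(s,X)$ and smooth real $f$. Let $(z^k)$ be a holomorphic chart on an open set $U\subset M$, $\{e_\alpha\}_{\alpha=1}^m$ a holomorphic frame of $E$ on $U$, and $(z^k,u^\alpha)$ the induced coordinates on $\pi^{-1}(U)$, $u=u^\alpha e_\alpha$. Define holomorphic functions on $U$ by $\rho(e_\alpha)=\rho^k_\alpha\,\partial/\partial z^k$ and $[e_\alpha,e_\beta]_E=\mathcal C^{\gamma}_{\alpha\beta}e_\gamma$, and sections over $\pi^{-1}(U)$ by $$\mathcal Z_\alpha(u)=\Big(e_\alpha(\pi(u)),\ \rho^k_\alpha\frac{\partial}{\partial z^k}\Big|_u\Big),\qquad \mathcal V_\alpha(u)=\Big(0,\ \frac{\partial}{\partial u^\alpha}\Big|_u\Big),\qquad \mathcal Z_{\bar\alpha}=\overline{\mathcal Z_\alpha},\quad \mathcal V_{\bar\alpha}=\overline{\mathcal V_\alpha},$$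 where $E$ is identified with $E'$ by $e\mapsto\frac12(e-iJe)$, so that the first component of $\mathcal Z_\alpha$ lies in $E'$. Then $\{\mathcal Z_\alpha,\mathcal V_\alpha,\mathcal Z_{\bar\alpha},\mathcal V_{\bar\alpha}\}$ is a basis of the fibre of $\mathcal T_{\mathbb C}E$ at every point of $\pi^{-1}(U)$, and on $\pi^{-1}(U)$, for all $\alpha,\beta$, $$[\mathcal Z_\alpha,\mathcal Z_\beta]_{\mathcal T}=\mathcal C^{\gamma}_{\alpha\beta}\mathcal Z_\gamma,\qquad [\mathcal Z_\alpha,\mathcal V_\beta]_{\mathcal T}=[\mathcal V_\alpha,\mathcal V_\beta]_{\mathcal T}=0,$$ $$[\mathcal Z_\alpha,\mathcal Z_{\bar\beta}]_{\mathcal T}=[\mathcal Z_\alpha,\mathcal V_{\bar\beta}]_{\mathcal T}=[\mathcal V_\alpha,\mathcal V_{\bar\beta}]_{\mathcal T}=0,$$ together with the conjugate relations $$[\mathcal Z_{\bar\alpha},\mathcal Z_{\bar\beta}]_{\mathcal T}=\overline{[\mathcal Z_\alpha,\mathcal Z_\beta]_{\mathcal T}}=\mathcal C^{\bar\gamma}_{\bar\alpha\bar\beta}\mathcal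 Z_{\bar\gamma},\quad \mathcal C^{\bar\gamma}_{\bar\alpha\bar\beta}:=\overline{\mathcal C^{\gamma}_{\alpha\beta}},\qquad [\mathcal Z_{\bar\alpha},\mathcal V_{\bar\beta}]_{\mathcal T}=[\mathcal V_{\bar\alpha},\mathcal V_{\bar\beta}]_{\mathcal T}=[\mathcal Z_{\bar\alpha},\mathcal Z_{\beta}]_{\mathcal T}=[\mathcal Z_{\bar\alpha},\mathcal V_{\beta}]_{\mathcal T}=[\mathcal V_{\bar\alpha},\mathcal V_{\beta}]_{\mathcal T}=0,$$ and the brackets of $\mathcal V_\alpha,\mathcal V_{\bar\alpha}$ with $\mathcal Z_\beta,\mathcal Z_{\bar\beta}$ (in this order) vanish as well. -/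

import Mathlib

open Bundle Set Filter Topology
open scoped Manifold ContDiff

noncomputable section

/-! ### Complexification of a real vector space -/

/-- The complexification `W ⊕ iW` of a real vector space `W`; `⟨a, b⟩` stands for `a + i b`. -/
@[ext]
structure Cplx (W : Type*) where
  re : W
  im : W

namespace Cplx

variable {W W' : Type*} [AddCommGroup W] [AddCommGroup W']

instance : Zero (Cplx W) := ⟨⟨0, 0⟩⟩
instance : Add (Cplx W) := ⟨fun x y => ⟨x.re + y.re, x.im + y.im⟩⟩
instance : Neg (Cplx W) := ⟨fun x => ⟨-x.re, -x.im⟩⟩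

@[simp] theorem zero_re : (0 : Cplx W).re = 0 := rfl
@[simp] theorem zero_im : (0 : Cplx W).im = 0 := rfl
@[simp] theorem add_re (x y : Cplx W) : (x + y).re = x.re + y.re := rfl
@[simp] theorem add_im (x y : Cplx W) : (x + y).im = x.im + y.im := rfl
@[simp] theorem neg_re (x : Cplx W) : (-x).re = -x.re := rfl
@[simp] theorem neg_im (x : Cplx W) : (-x).im = -x.im := rfl

instance : AddCommGroup (Cplx W) where
  add_assoc x y z := by ext <;> simp [add_assoc]
  zero_add x := by ext <;> simp
  add_zero x := by ext <;> simp
  neg_add_cancel x := by ext <;> simp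
  add_comm x y := by ext <;> simp [add_comm]
  nsmul := nsmulRec
  zsmul := zsmulRec

variable [Module ℝ W] [Module ℝ W']

instance : SMul ℂ (Cplx W) :=
  ⟨fun c x => ⟨c.re • x.re - c.im • x.im, c.re • x.im + c.im • x.re⟩⟩

@[simp] theorem smul_re (c : ℂ) (x : Cplx W) : (c • x).re = c.re • x.re - c.im • x.im := rfl
@[simp] theorem smul_im (c : ℂ) (x : Cplx W) : (c • x).im = c.re • x.im + c.im • x.re := rfl

instance : Module ℂ (Cplx W) where
  one_smul x := by ext <;> simp
  mul_smul c d x := by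
    ext
    · simp only [smul_re, smul_im, Complex.mul_re, Complex.mul_im]; module
    · simp only [smul_re, smul_im, Complex.mul_re, Complex.mul_im]; module
  smul_zero c := by ext <;> simp
  smul_add c x y := by
    ext
    · simp only [smul_re, add_re, add_im]; module
    · simp only [smul_im, add_re, add_im]; module
  add_smul c d x := by
    ext
    · simp only [smul_re, add_re, Complex.add_re, Complex.add_im]; module
    · simp only [smul_im, add_im, Complex.add_re, Complex.add_im]; module
  zero_smul x := by ext <;> simp

/-- Complex conjugation `a + i b ↦ a - i b`. -/
def conj (x : Cplx W) : Cplx W := ⟨x.re, -x.im⟩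

/-- The `ℂ`-linear extension of a real linear map. -/
def map (f : W →ₗ[ℝ] W') : Cplx W →ₗ[ℂ] Cplx W' where
  toFun x := ⟨f x.re, f x.im⟩
  map_add' x y := by ext <;> simp
  map_smul' c x := by ext <;> simp

/-- For a complex vector space `W` with complex structure `J w = i w`, the identification of `W`
with the `(1,0)`-part of its complexification: `w ↦ w' = (w - i J w) / 2`. -/
def hol {W : Type*} [AddCommGroup W] [Module ℂ W] (w : W) : Cplx W :=
  ⟨(1 / 2 : ℝ) • w, -((1 / 2 : ℝ) • (Complex.I • w))⟩

end Cplx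

/-! ### Holomorphic Lie algebroids -/

/-- The model space of an `n`-dimensional complex manifold (also the typical fibre of a
vector bundle of rank `n`). -/
abbrev CModel (n : ℕ) : Type := Fin n → ℂ

/-- The model with corners of the complex manifold `E` (total space of a bundle of rank `m`
over a manifold of dimension `n`). -/
abbrev totalModelC (n m : ℕ) :
    ModelWithCorners ℂ (CModel n × CModel m) (ModelProd (CModel n) (CModel m)) :=
  𝓘(ℂ, CModel n).prod 𝓘(ℂ, CModel m)

/-- The model with corners of the underlying real manifold of `E`. -/
abbrev totalModelR (n m : ℕ) :
    ModelWithCorners ℝ (CModel n × CModel m) (ModelProd (CModel n) (CModel m)) :=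
  𝓘(ℝ, CModel n).prod 𝓘(ℝ, CModel m)

section Algebroid

variable {n m : ℕ} {M : Type*} [TopologicalSpace M] [ChartedSpace (CModel n) M]
  [IsManifold 𝓘(ℂ, CModel n) ω M] {E : M → Type*} [TopologicalSpace (TotalSpace (CModel m) E)]
  [∀ x, AddCommGroup (E x)] [∀ x, Module ℂ (E x)] [∀ x, TopologicalSpace (E x)]
  [FiberBundle (CModel m) E]

variable (n m) in
/-- The section `s` of `E` is holomorphic (complex analytic) near `x`. -/
def IsHolAt (s : ∀ x, E x) (x : M) : Prop :=
  ContMDiffAt 𝓘(ℂ, CModel n) (totalModelC n m) ω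
    (fun y => (⟨y, s y⟩ : TotalSpace (CModel m) E)) x

/-- The derivative of a function `f : M → ℂ` at `x` in the direction of a holomorphic tangent
vector `v`. -/
def holDeriv (f : M → ℂ) (x : M) (v : TangentSpace 𝓘(ℂ, CModel n) x) : ℂ :=
  mfderiv 𝓘(ℂ, CModel n) 𝓘(ℂ) f x v

variable (n m M E) in
/-- A holomorphic Lie algebroid structure on a holomorphic vector bundle `E` of rank `m` over a
complex manifold `M` of dimension `n`: a holomorphic bundle morphism `anchor : E → T'M` and a Lie
bracket on (local) holomorphic sections satisfying the Leibniz rule. A bracket on the sheaf of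
holomorphic sections is encoded by its values `bracket s t x`; these matter only where `s` and `t`
are holomorphic near `x`, and depend only on the germs of `s` and `t` at `x`. -/
structure HolLieAlgebroid where
  anchor : ∀ x : M, E x →ₗ[ℂ] TangentSpace 𝓘(ℂ, CModel n) x
  anchor_hol : ContMDiff (totalModelC n m) 𝓘(ℂ, CModel n).tangent ω
    (fun u : TotalSpace (CModel m) E =>
      (⟨u.proj, anchor u.proj u.2⟩ : TangentBundle 𝓘(ℂ, CModel n) M))
  bracket : (∀ x, E x) → (∀ x, E x) → (∀ x, E x)
  bracket_congr : ∀ (s s' t t' : ∀ x, E x) (x : M), IsHolAt n m s x → IsHolAt n m t x →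
    (∀ᶠ y in 𝓝 x, s y = s' y) → (∀ᶠ y in 𝓝 x, t y = t' y) → bracket s t x = bracket s' t' x
  bracket_hol : ∀ (s t : ∀ x, E x) (x : M), IsHolAt n m s x → IsHolAt n m t x →
    IsHolAt n m (bracket s t) x
  bracket_add : ∀ (s t t' : ∀ x, E x) (x : M),
    IsHolAt n m s x → IsHolAt n m t x → IsHolAt n m t' x →
    bracket s (t + t') x = bracket s t x + bracket s t' x
  bracket_smul : ∀ (c : ℂ) (s t : ∀ x, E x) (x : M), IsHolAt n m s x → IsHolAt n m t x →
    bracket s (c • t) x = c • bracket s t x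
  bracket_skew : ∀ (s t : ∀ x, E x) (x : M), IsHolAt n m s x → IsHolAt n m t x →
    bracket s t x = -bracket t s x
  jacobi : ∀ (s t r : ∀ x, E x) (x : M), IsHolAt n m s x → IsHolAt n m t x → IsHolAt n m r x →
    bracket s (bracket t r) x + bracket t (bracket r s) x + bracket r (bracket s t) x = 0
  leibniz : ∀ (f : M → ℂ) (s t : ∀ x, E x) (x : M),
    ContMDiffAt 𝓘(ℂ, CModel n) 𝓘(ℂ) ω f x → IsHolAt n m s x → IsHolAt n m t x →
    bracket s (fun y => f y • t y) x
      = f x • bracket s t x + holDeriv f x (anchor x (s x)) • t x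

/-! ### The complexified prolongation

The tangent space of the complex manifold `E` at `u` is a complex vector space; its elements are
also the tangent vectors at `u` of the underlying real manifold, multiplication by `i` being the
complex structure `J`. So `Cplx (TangentSpace (totalModelC n m) u)` is the complexified tangent
space `T_ℂ E` at `u`, and similarly for `T_ℂ M`. -/

variable (n m E) in
/-- The fibre at `u` of `E_ℂ × T_ℂ E`. -/
abbrev AmbientFibre (u : TotalSpace (CModel m) E) : Type _ :=
  Cplx (E u.proj) × Cplx (TangentSpace (totalModelC n m) u)

variable (n m E) in
/-- The tangent map at `u` of the bundle projection `π : E → M`. -/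
def projDeriv (u : TotalSpace (CModel m) E) :
    TangentSpace (totalModelC n m) u →ₗ[ℂ] TangentSpace 𝓘(ℂ, CModel n) u.proj :=
  (mfderiv (totalModelC n m) 𝓘(ℂ, CModel n)
    (fun w : TotalSpace (CModel m) E => w.proj) u).toLinearMap

namespace HolLieAlgebroid

variable (L : HolLieAlgebroid n m M E)

/-- The fibre at `u` of the complexified prolongation of `E`: all pairs `(e, v)` in
`E_ℂ × T_ℂ E` over `u` with `ρ_ℂ(e) = π_{*,ℂ}(v)`. -/
def prolongation (u : TotalSpace (CModel m) E) : Submodule ℂ (AmbientFibre n m E u) :=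
  LinearMap.ker
    ((Cplx.map ((L.anchor u.proj).restrictScalars ℝ)).comp
        (LinearMap.fst ℂ (Cplx (E u.proj)) (Cplx (TangentSpace (totalModelC n m) u)))
      - (Cplx.map ((projDeriv n m E u).restrictScalars ℝ)).comp
        (LinearMap.snd ℂ (Cplx (E u.proj)) (Cplx (TangentSpace (totalModelC n m) u))))

end HolLieAlgebroid

/-- The map `TotalSpace → F` representing `s`, a section of the pullback of `E` along `π`, in the
distinguished trivialization of `E` around `b`. -/
def fibreCoord (b : M) (s : ∀ u : TotalSpace (CModel m) E, E u.proj) :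
    TotalSpace (CModel m) E → CModel m :=
  fun u => (trivializationAt (CModel m) E b ⟨u.proj, s u⟩).2

/-- The derivative of a smooth vector valued function `g` on the real manifold `E` at `u` in the
direction of a real tangent vector `v`. -/
def realDeriv (g : TotalSpace (CModel m) E → CModel m) (u : TotalSpace (CModel m) E)
    (v : TangentSpace (totalModelC n m) u) : CModel m :=
  mfderiv (totalModelR n m) 𝓘(ℝ, CModel m) g u v

namespace HolLieAlgebroid

variable (L : HolLieAlgebroid n m M E)

/-- The bracket at `b` of the sections of `E` that are constant, equal to `a` and to `a'`, in the
distinguished trivialization around `b` (expressed in that trivialization). In terms of the frame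
`ε_α` given by this trivialization it is `C^γ_{αβ}(b) a^α a'^β`. -/
def constBracket (b : M) (a a' : CModel m) : CModel m :=
  (trivializationAt (CModel m) E b ⟨b, L.bracket
    (fun x => (trivializationAt (CModel m) E b).symm x a)
    (fun x => (trivializationAt (CModel m) E b).symm x a') b⟩).2

/-- The bracket of two real sections `(s, X)`, `(t, Y)` of the prolongation (`s`, `t` sections of
`π^*E`, `X`, `Y` vector fields on the real manifold `E`, with `π_* X = ρ(s)`, `π_* Y = ρ(t)`).

It is the bracket determined by the Leibniz rule `[Z, f W] = f [Z, W] + ρ_𝒯(Z)(f) W` and by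
`[(σ ∘ π, X), (τ ∘ π, Y)] = ([σ, τ] ∘ π, [X, Y])` for holomorphic sections `σ`, `τ` of `E`.
Explicitly: the second component is the Lie bracket of vector fields `[X, Y]`, and if
`s = s^α ε_α`, `t = t^α ε_α` in the distinguished holomorphic frame around `π(u)`,
then the first component at `u` is `(X(t^γ) - Y(s^γ) + C^γ_{αβ} s^α t^β) ε_γ`. -/
def realBracket (s t : ∀ u : TotalSpace (CModel m) E, E u.proj)
    (X Y : ∀ u : TotalSpace (CModel m) E, TangentSpace (totalModelC n m) u)
    (u : TotalSpace (CModel m) E) : E u.proj × TangentSpace (totalModelC n m) u :=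
  ((trivializationAt (CModel m) E u.proj).symm u.proj
      (realDeriv (fibreCoord u.proj t) u (X u) - realDeriv (fibreCoord u.proj s) u (Y u)
        + L.constBracket u.proj (fibreCoord u.proj s u) (fibreCoord u.proj t u)),
    VectorField.mlieBracket (totalModelR n m) X Y u)

/-- The bracket `[Z, W]_𝒯` of two sections of the complexified prolongation: the `ℂ`-bilinear
extension of the bracket of real sections. -/
def prolongBracket (Z W : ∀ u : TotalSpace (CModel m) E, AmbientFibre n m E u)
    (u : TotalSpace (CModel m) E) : AmbientFibre n m E u :=
  let rr := L.realBracket (fun u => (Z u).1.re) (fun u => (W u).1.re)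
    (fun u => (Z u).2.re) (fun u => (W u).2.re) u
  let ii := L.realBracket (fun u => (Z u).1.im) (fun u => (W u).1.im)
    (fun u => (Z u).2.im) (fun u => (W u).2.im) u
  let ri := L.realBracket (fun u => (Z u).1.re) (fun u => (W u).1.im)
    (fun u => (Z u).2.re) (fun u => (W u).2.im) u
  let ir := L.realBracket (fun u => (Z u).1.im) (fun u => (W u).1.re)
    (fun u => (Z u).2.im) (fun u => (W u).2.re) u
  (⟨rr.1 - ii.1, ri.1 + ir.1⟩, ⟨rr.2 - ii.2, ri.2 + ir.2⟩)

end HolLieAlgebroid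

/-- Conjugation on `E_ℂ × T_ℂ E`. -/
def conjFibre {u : TotalSpace (CModel m) E} (p : AmbientFibre n m E u) : AmbientFibre n m E u :=
  (p.1.conj, p.2.conj)

/-! ### Local coordinates and the natural local basis

`φ` is a complex chart of `M` with coordinates `z^k`, and `e_α` a holomorphic frame of `E` on the
domain of `φ`. -/

section Frame

variable (φ : OpenPartialHomeomorph M (CModel n)) (e : Fin m → ∀ x, E x)

/-- The local parametrization of `E` with coordinates `(z^k, u^α)`. -/
def bundleParam (p : CModel n × CModel m) : TotalSpace (CModel m) E :=
  ⟨φ.symm p.1, ∑ α, p.2 α • e α (φ.symm p.1)⟩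

variable {φ e} in
/-- The coordinates `(z^k, u^α)` of a point `u = u^α e_α` of `E` over the domain of `φ`. -/
def bundleCoord (he : IsLocalFrameOn 𝓘(ℂ, CModel n) (CModel m) ω e φ.source)
    (u : TotalSpace (CModel m) E) : CModel n × CModel m :=
  (φ u.proj, fun α => he.coeff α u.proj u.2)

variable {φ e}
variable (he : IsLocalFrameOn 𝓘(ℂ, CModel n) (CModel m) ω e φ.source)

/-- The holomorphic tangent vector `∂/∂z^k` of `E` at `u` in the coordinates `(z^k, u^α)`. -/
def partialZ (k : Fin n) (u : TotalSpace (CModel m) E) : TangentSpace (totalModelC n m) u :=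
  mfderiv 𝓘(ℂ, CModel n × CModel m) (totalModelC n m) (bundleParam φ e) (bundleCoord he u)
    ((Pi.single k 1, 0) : CModel n × CModel m)

/-- The holomorphic tangent vector `∂/∂u^α` of `E` at `u` in the coordinates `(z^k, u^α)`. -/
def partialU (α : Fin m) (u : TotalSpace (CModel m) E) : TangentSpace (totalModelC n m) u :=
  mfderiv 𝓘(ℂ, CModel n × CModel m) (totalModelC n m) (bundleParam φ e) (bundleCoord he u)
    ((0, Pi.single α 1) : CModel n × CModel m)

namespace HolLieAlgebroid

variable (L : HolLieAlgebroid n m M E)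

variable (φ e) in
/-- The anchor coefficients `ρ^k_α`, defined by `ρ(e_α) = ρ^k_α ∂/∂z^k`. -/
def anchorCoeff (α : Fin m) (k : Fin n) (x : M) : ℂ :=
  (mfderiv 𝓘(ℂ, CModel n) 𝓘(ℂ, CModel n) φ x (L.anchor x (e α x)) : CModel n) k

/-- The structure functions `C^γ_{αβ}`, defined by `[e_α, e_β] = C^γ_{αβ} e_γ`. -/
def structureFn (α β γ : Fin m) (x : M) : ℂ :=
  he.coeff γ x (L.bracket (e α) (e β) x)

/-- `𝒵_α(u) = (e_α(π(u)), ρ^k_α ∂/∂z^k)`. -/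
def secZ (α : Fin m) (u : TotalSpace (CModel m) E) : AmbientFibre n m E u :=
  (Cplx.hol (e α u.proj),
    ∑ k, L.anchorCoeff φ e α k u.proj • Cplx.hol (partialZ he k u))

/-- The conjugate `𝒵_ᾱ` of `𝒵_α`. -/
def secZbar (α : Fin m) (u : TotalSpace (CModel m) E) : AmbientFibre n m E u :=
  conjFibre (L.secZ he α u)

end HolLieAlgebroid

/-- `𝒱_α(u) = (0, ∂/∂u^α)`. -/
def secV (α : Fin m) (u : TotalSpace (CModel m) E) : AmbientFibre n m E u :=
  (0, Cplx.hol (partialU he α u))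

/-- The conjugate `𝒱_ᾱ` of `𝒱_α`. -/
def secVbar (α : Fin m) (u : TotalSpace (CModel m) E) : AmbientFibre n m E u :=
  conjFibre (secV he α u)

/-- The natural local frame `{𝒵_α, 𝒱_α, 𝒵_ᾱ, 𝒱_ᾱ}` of the complexified prolongation, at `u`. -/
def HolLieAlgebroid.naturalFrame (L : HolLieAlgebroid n m M E) (u : TotalSpace (CModel m) E) :
    (Fin m ⊕ Fin m) ⊕ (Fin m ⊕ Fin m) → AmbientFibre n m E u :=
  Sum.elim (Sum.elim (fun α => L.secZ he α u) (fun α => secV he α u))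
    (Sum.elim (fun α => L.secZbar he α u) (fun α => secVbar he α u))

end Frame

end Algebroid

end

/-!
Regard a pair in `E × TE` over `u` as a vector of a complex vector space. The vectors `𝒵_α` and
`𝒱_α` are the `(1,0)`-parts of the lifts `(e_α, ρ^k_α ∂/∂z^k)` and of the vertical pairs
`(0, ∂/∂u^α)`, which form a basis of the kernel of `ρ - π_*`; the fibre of the complexified
prolongation is the direct sum of the `(1,0)`-part of this kernel and its conjugate.

On holomorphic pairs the bracket of real sections is complex bilinear. Hence the bracket of the
`(1,0)`-parts of two such pairs is the `(1,0)`-part of their bracket, and the bracket of a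
`(1,0)`-part with a conjugate vanishes, because `(1 - i J)(1 + i J) = 1 + J² = 0`. The brackets of
lifts are determined by `[ρ(s), ρ(t)] = ρ([s, t])`, which the Jacobi identity and the Leibniz rule
force on an algebroid of positive rank.
-/

noncomputable section

section RestrictScalars

section Models

variable {𝕜 𝕜' V H N : Type*} [NontriviallyNormedField 𝕜] [NontriviallyNormedField 𝕜']
  [NormedAddCommGroup V] [NormedSpace 𝕜 V] [NormedSpace 𝕜' V]
  [TopologicalSpace H] [TopologicalSpace N] [ChartedSpace H N]
  {I : ModelWithCorners 𝕜' V H} {J : ModelWithCorners 𝕜 V H}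

theorem extChartAt_eq_of_toPartialEquiv_eq (hIJ : I.toPartialEquiv = J.toPartialEquiv) (x : N) :
    extChartAt I x = extChartAt J x := by
  simp only [extChartAt, OpenPartialHomeomorph.extend, hIJ]

theorem range_eq_of_toPartialEquiv_eq (hIJ : I.toPartialEquiv = J.toPartialEquiv) :
    range I = range J :=
  congrArg (fun p : PartialEquiv H V => range p) hIJ

end Models

variable {𝕜 𝕜' V H N V' H' N' : Type*} [NontriviallyNormedField 𝕜] [NontriviallyNormedField 𝕜']
  [NormedAlgebra 𝕜 𝕜']
  [NormedAddCommGroup V] [NormedSpace 𝕜 V] [NormedSpace 𝕜' V] [IsScalarTower 𝕜 𝕜' V]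
  [NormedAddCommGroup V'] [NormedSpace 𝕜 V'] [NormedSpace 𝕜' V'] [IsScalarTower 𝕜 𝕜' V']

theorem inverse_restrictScalars {A : V →L[𝕜'] V'} (hA : A.IsInvertible) :
    (A.restrictScalars 𝕜).inverse = A.inverse.restrictScalars 𝕜 := by
  obtain ⟨e, rfl⟩ := hA
  rw [ContinuousLinearMap.inverse_equiv]
  exact ContinuousLinearMap.inverse_eq (by ext; simp) (by ext; simp)

variable [TopologicalSpace H] [TopologicalSpace N] [ChartedSpace H N]
  [TopologicalSpace H'] [TopologicalSpace N'] [ChartedSpace H' N']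
  {I : ModelWithCorners 𝕜' V H} {J : ModelWithCorners 𝕜 V H}
  {I' : ModelWithCorners 𝕜' V' H'} {J' : ModelWithCorners 𝕜 V' H'}

theorem hasMFDerivWithinAt_restrictScalars (hIJ : I.toPartialEquiv = J.toPartialEquiv)
    (hIJ' : I'.toPartialEquiv = J'.toPartialEquiv) {f : N → N'} {s : Set N} {x : N}
    {f' : V →L[𝕜'] V'} (hf : HasMFDerivWithinAt I I' f s x f') :
    HasMFDerivWithinAt J J' f s x (f'.restrictScalars 𝕜) := by
  refine ⟨hf.1, ?_⟩
  have hderiv := HasFDerivWithinAt.restrictScalars 𝕜 hf.2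
  simp only [writtenInExtChartAt, extChartAt_eq_of_toPartialEquiv_eq hIJ,
    extChartAt_eq_of_toPartialEquiv_eq hIJ', range_eq_of_toPartialEquiv_eq hIJ] at hderiv ⊢
  exact hderiv

theorem inverse_mfderivWithin_restrictScalars (hIJ : I.toPartialEquiv = J.toPartialEquiv)
    (hIJ' : I'.toPartialEquiv = J'.toPartialEquiv) {f : N → N'} {s : Set N} {x : N}
    {A : V →L[𝕜'] V'} (hf : HasMFDerivWithinAt I I' f s x A) (hA : A.IsInvertible)
    (hs : UniqueMDiffWithinAt J s x) (v : V') :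
    (mfderivWithin J J' f s x).inverse v = A.inverse v := by
  rw [(hasMFDerivWithinAt_restrictScalars hIJ hIJ' hf).mfderivWithin hs]
  exact DFunLike.congr_fun (inverse_restrictScalars hA) v

theorem hasMFDerivAt_restrictScalars (hIJ : I.toPartialEquiv = J.toPartialEquiv)
    (hIJ' : I'.toPartialEquiv = J'.toPartialEquiv) {f : N → N'} {x : N}
    {f' : V →L[𝕜'] V'} (hf : HasMFDerivAt I I' f x f') :
    HasMFDerivAt J J' f x (f'.restrictScalars 𝕜) :=
  hasMFDerivWithinAt_univ.1
    (hasMFDerivWithinAt_restrictScalars hIJ hIJ' (hasMFDerivWithinAt_univ.2 hf))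

variable [IsManifold I 2 N]

theorem inverse_mfderiv_extChartAt_restrictScalars (hIJ : I.toPartialEquiv = J.toPartialEquiv)
    (x : N) (v : V) :
    (mfderiv J 𝓘(𝕜, V) (extChartAt J x) x).inverse v
      = (mfderiv I 𝓘(𝕜', V) (extChartAt I x) x).inverse v := by
  have hdiff := (mdifferentiableAt_extChartAt (I := I) (mem_chart_source H x)).hasMFDerivAt
  rw [← extChartAt_eq_of_toPartialEquiv_eq hIJ, ← mfderivWithin_univ]
  exact inverse_mfderivWithin_restrictScalars (J' := 𝓘(𝕜, V)) hIJ rfl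
    (hasMFDerivWithinAt_univ.2 hdiff) (isInvertible_mfderiv_extChartAt (mem_extChartAt_source x))
    (uniqueMDiffWithinAt_univ J) v

theorem mpullbackWithin_extChartAt_symm_restrictScalars
    (hIJ : I.toPartialEquiv = J.toPartialEquiv) (X : N → V) (x : N) {y : V}
    (hy : y ∈ (extChartAt I x).target) :
    VectorField.mpullbackWithin 𝓘(𝕜, V) J (extChartAt J x).symm X (range J) y
      = VectorField.mpullbackWithin 𝓘(𝕜', V) I (extChartAt I x).symm X (range I) y := by
  have hdiff := (mdifferentiableWithinAt_extChartAt_symm (I := I) hy).hasMFDerivWithinAt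
  have hunique : UniqueMDiffWithinAt 𝓘(𝕜, V) (range I) y := by
    rw [range_eq_of_toPartialEquiv_eq hIJ]
    exact J.uniqueMDiffOn _
      ((range_eq_of_toPartialEquiv_eq hIJ).subset (extChartAt_target_subset_range x hy))
  rw [← extChartAt_eq_of_toPartialEquiv_eq hIJ, ← range_eq_of_toPartialEquiv_eq hIJ]
  exact inverse_mfderivWithin_restrictScalars (I := 𝓘(𝕜', V)) (J := 𝓘(𝕜, V)) rfl hIJ
    hdiff (isInvertible_mfderivWithin_extChartAt_symm hy) hunique _

theorem lieBracketWithin_restrictScalars {X Y : V → V} {s : Set V} {x : V}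
    (hs : UniqueDiffWithinAt 𝕜 s x) (hX : DifferentiableWithinAt 𝕜' X s x)
    (hY : DifferentiableWithinAt 𝕜' Y s x) :
    VectorField.lieBracketWithin 𝕜 X Y s x = VectorField.lieBracketWithin 𝕜' X Y s x := by
  rw [VectorField.lieBracketWithin, VectorField.lieBracketWithin,
    ← hX.restrictScalars_fderivWithin 𝕜 hs, ← hY.restrictScalars_fderivWithin 𝕜 hs]
  rfl

theorem mlieBracket_restrictScalars [CompleteSpace V] (hIJ : I.toPartialEquiv = J.toPartialEquiv)
    {X Y : ∀ y : N, TangentSpace I y} {x : N}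
    (hX : MDifferentiableAt I I.tangent (fun y => (⟨y, X y⟩ : TangentBundle I N)) x)
    (hY : MDifferentiableAt I I.tangent (fun y => (⟨y, Y y⟩ : TangentBundle I N)) x) :
    VectorField.mlieBracket J X Y x = VectorField.mlieBracket I X Y x := by
  rw [← mdifferentiableWithinAt_univ] at hX hY
  have hmem : extChartAt I x x ∈ range I :=
    extChartAt_target_subset_range x (mem_extChartAt_target x)
  have hpull (Z : N → V) :
      VectorField.mpullbackWithin 𝓘(𝕜, V) J (extChartAt J x).symm Z (range J)
        =ᶠ[𝓝[range I] (extChartAt I x x)]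
      VectorField.mpullbackWithin 𝓘(𝕜', V) I (extChartAt I x).symm Z (range I) := by
    filter_upwards [extChartAt_target_mem_nhdsWithin x] with y hy
    exact mpullbackWithin_extChartAt_symm_restrictScalars hIJ Z x hy
  have hunique : UniqueDiffWithinAt 𝕜 (range I) (extChartAt I x x) := by
    rw [range_eq_of_toPartialEquiv_eq hIJ] at hmem ⊢
    exact J.uniqueDiffOn _ hmem
  have hdiff {Z : ∀ y : N, TangentSpace I y} (hZ : MDifferentiableWithinAt I I.tangent
      (fun y => (⟨y, Z y⟩ : TangentBundle I N)) univ x) :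
      DifferentiableWithinAt 𝕜'
        (VectorField.mpullbackWithin 𝓘(𝕜', V) I (extChartAt I x).symm Z (range I))
        (range I) (extChartAt I x x) := by
    have := hZ.differentiableWithinAt_mpullbackWithin_vectorField
    rwa [preimage_univ, univ_inter] at this
  have hlie := ((hpull X).lieBracketWithin_vectorField_eq_of_mem (hpull Y) hmem).trans
    (lieBracketWithin_restrictScalars hunique (hdiff hX) (hdiff hY))
  refine Eq.trans (congrArg (mfderiv J 𝓘(𝕜, V) (extChartAt J x) x).inverse ?_)
    (inverse_mfderiv_extChartAt_restrictScalars hIJ x _)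
  rw [preimage_univ, univ_inter, preimage_univ, univ_inter, ← hlie,
    extChartAt_eq_of_toPartialEquiv_eq hIJ, range_eq_of_toPartialEquiv_eq hIJ]

end RestrictScalars

section SemilinearImages

variable {R V W W' ι ι' : Type*} [Ring R] [AddCommGroup V] [Module R V] [AddCommGroup W]
  [Module R W] [AddCommGroup W'] [Module R W'] {σ τ : R →+* R} [RingHomSurjective σ]
  [RingHomSurjective τ] {f : W →ₛₗ[σ] V} {g : W' →ₛₗ[τ] V} {v : ι → W} {w : ι' → W'}

theorem span_range_sumElim_comp :
    Submodule.span R (range (Sum.elim (f ∘ v) (g ∘ w)))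
      = (Submodule.span R (range v)).map f ⊔ (Submodule.span R (range w)).map g := by
  rw [Sum.elim_range, Submodule.span_union, Submodule.map_span, Submodule.map_span, ← range_comp,
    ← range_comp]

theorem linearIndependent_sumElim_comp (hfg : ∀ x y, f x + g y = 0 → x = 0 ∧ y = 0)
    (hv : LinearIndependent R v) (hw : LinearIndependent R w) :
    LinearIndependent R (Sum.elim (f ∘ v) (g ∘ w)) := by
  have hf : ∀ x, f x = 0 → x = 0 := fun x hx => (hfg x 0 (by rw [hx, map_zero, add_zero])).1
  have hg : ∀ y, g y = 0 → y = 0 := fun y hy => (hfg 0 y (by rw [hy, map_zero, add_zero])).2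
  refine LinearIndependent.sum_type
    (hv.map_of_surjective_injective σ f.toAddMonoidHom σ.surjective hf f.map_smulₛₗ)
    (hw.map_of_surjective_injective τ g.toAddMonoidHom τ.surjective hg g.map_smulₛₗ) ?_
  have hspan_f : Submodule.span R (range (f ∘ v)) ≤ LinearMap.range f :=
    Submodule.span_le.2 (range_comp_subset_range v f)
  have hspan_g : Submodule.span R (range (g ∘ w)) ≤ LinearMap.range g :=
    Submodule.span_le.2 (range_comp_subset_range w g)
  refine Disjoint.mono hspan_f hspan_g (Submodule.disjoint_def.2 ?_)
  rintro _ ⟨x, rfl⟩ ⟨y, hy⟩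
  rw [(hfg x (-y) (by rw [map_neg, hy, add_neg_cancel])).1, map_zero]

end SemilinearImages

namespace Cplx

section Conj

variable {W W' : Type*} [AddCommGroup W] [Module ℝ W] [AddCommGroup W'] [Module ℝ W']

/-- Conjugation of a complexification as a semilinear map. -/
def conjₗ : Cplx W →ₛₗ[starRingEnd ℂ] Cplx W where
  toFun := conj
  map_add' x y := by
    ext
    · rfl
    · exact neg_add _ _
  map_smul' c x := by
    ext
    · simp only [conj, smul_re, Complex.conj_re, Complex.conj_im]
      module
    · simp only [conj, smul_im, Complex.conj_re, Complex.conj_im]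
      module

theorem map_conj (f : W →ₗ[ℝ] W') (z : Cplx W) : map f z.conj = (map f z).conj :=
  Cplx.ext rfl (map_neg f z.im)

end Conj

variable {W W' : Type*} [AddCommGroup W] [Module ℂ W] [AddCommGroup W'] [Module ℂ W']

/-- The element `a w + i b w` of the complexification of a complex vector space `W`, where `a w`
and `b w` are formed in `W`. Both `w'` and its conjugate are of this form. -/
def ofScalars (a b : ℂ) (w : W) : Cplx W := ⟨a • w, b • w⟩

theorem hol_eq_ofScalars (w : W) : hol w = ofScalars (1 / 2) (-(Complex.I / 2)) w := by
  have h : (1 / 2 : ℝ) • w = (1 / 2 : ℂ) • w := by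
    rw [← Complex.coe_smul]
    norm_num
  have hI : -((1 / 2 : ℝ) • (Complex.I • w)) = (-(Complex.I / 2)) • w := by
    rw [← Complex.coe_smul, smul_smul, ← neg_smul]
    congr 1
    push_cast
    ring
  exact Cplx.ext h hI

theorem conj_hol_eq_ofScalars (w : W) : (hol w).conj = ofScalars (1 / 2) (Complex.I / 2) w := by
  rw [hol_eq_ofScalars]
  exact Cplx.ext rfl (by simp only [conj, ofScalars, neg_smul, neg_neg])

/-- The identification of `W` with the `(1,0)`-part of its complexification as a linear map. -/
def holₗ : W →ₗ[ℂ] Cplx W where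
  toFun := hol
  map_add' x y := by
    simp only [hol_eq_ofScalars, ofScalars, smul_add]
    rfl
  map_smul' c x := by
    simp only [hol_eq_ofScalars, ofScalars]
    ext
    · simp only [smul_re, RingHom.id_apply, ← Complex.coe_smul, smul_smul, ← sub_smul]
      congr 1
      apply Complex.ext <;> simp <;> ring
    · simp only [smul_im, RingHom.id_apply, ← Complex.coe_smul, smul_smul, ← add_smul]
      congr 1
      apply Complex.ext <;> simp <;> ring

theorem map_hol (f : W →ₗ[ℂ] W') (w : W) : map (f.restrictScalars ℝ) (hol w) = hol (f w) := by
  simp only [hol_eq_ofScalars, ofScalars, ← map_smul]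
  rfl

theorem eq_zero_of_hol_add_conj_hol {x y : W} (h : hol x + (hol y).conj = 0) : x = 0 ∧ y = 0 := by
  rw [conj_hol_eq_ofScalars, hol_eq_ofScalars] at h
  have hre : (1 / 2 : ℂ) • x + (1 / 2 : ℂ) • y = 0 := congrArg re h
  have him : (-(Complex.I / 2)) • x + (Complex.I / 2) • y = 0 := congrArg im h
  have hsum : x + y = 0 := by linear_combination (norm := module) (2 : ℂ) • hre
  have hI : Complex.I • (x - y) = 0 := by linear_combination (norm := module) (-2 : ℂ) • him
  have hdiff : x - y = 0 := (smul_eq_zero.1 hI).resolve_left Complex.I_ne_zero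
  constructor
  · linear_combination (norm := module) (1 / 2 : ℂ) • hsum + (1 / 2 : ℂ) • hdiff
  · linear_combination (norm := module) (1 / 2 : ℂ) • hsum - (1 / 2 : ℂ) • hdiff

theorem exists_hol_add_conj_hol (z : Cplx W) : ∃ x y : W, hol x + (hol y).conj = z := by
  refine ⟨z.re + Complex.I • z.im, z.re - Complex.I • z.im, ?_⟩
  have hI : Complex.I / 2 * Complex.I = -(1 / 2) := by
    rw [div_mul_eq_mul_div, Complex.I_mul_I, neg_div]
  rw [conj_hol_eq_ofScalars, hol_eq_ofScalars]
  ext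
  · simp only [ofScalars, add_re]
    module
  · simp only [ofScalars, add_im, smul_add, smul_sub, smul_smul, neg_mul, hI]
    module

end Cplx

section Prolongation

variable {n m : ℕ} {M : Type*} [TopologicalSpace M] [ChartedSpace (CModel n) M]
  {E : M → Type*} [TopologicalSpace (TotalSpace (CModel m) E)]
  [∀ x, AddCommGroup (E x)] [∀ x, Module ℂ (E x)] [∀ x, TopologicalSpace (E x)]
  [FiberBundle (CModel m) E] {u : TotalSpace (CModel m) E}

variable (n m E) in
/-- The fibre at `u` of `E × TE`, as a complex vector space. -/
abbrev HolFibre (u : TotalSpace (CModel m) E) : Type _ :=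
  E u.proj × TangentSpace (totalModelC n m) u

/-- The identification of `E_π(u) × T_u E` with the `(1,0)`-part of `E_ℂ × T_ℂ E`. -/
def holFibreₗ : HolFibre n m E u →ₗ[ℂ] AmbientFibre n m E u :=
  LinearMap.prodMap Cplx.holₗ Cplx.holₗ

/-- Conjugation of `E_ℂ × T_ℂ E` as a semilinear map. -/
def conjFibreₗ : AmbientFibre n m E u →ₛₗ[starRingEnd ℂ] AmbientFibre n m E u where
  toFun := conjFibre
  map_add' p q := Prod.ext (map_add Cplx.conjₗ p.1 q.1) (map_add Cplx.conjₗ p.2 q.2)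
  map_smul' c p :=
    Prod.ext (Cplx.conjₗ.map_smulₛₗ c p.1) (Cplx.conjₗ.map_smulₛₗ c p.2)

theorem eq_zero_of_holFibre_add_conj {p q : HolFibre n m E u}
    (h : holFibreₗ p + conjFibreₗ (holFibreₗ q) = 0) : p = 0 ∧ q = 0 := by
  obtain ⟨hp₁, hq₁⟩ := Cplx.eq_zero_of_hol_add_conj_hol (congrArg Prod.fst h)
  obtain ⟨hp₂, hq₂⟩ := Cplx.eq_zero_of_hol_add_conj_hol (congrArg Prod.snd h)
  exact ⟨Prod.ext hp₁ hp₂, Prod.ext hq₁ hq₂⟩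

theorem exists_holFibre_add_conj (z : AmbientFibre n m E u) :
    ∃ p q : HolFibre n m E u, holFibreₗ p + conjFibreₗ (holFibreₗ q) = z := by
  obtain ⟨p₁, q₁, h₁⟩ := Cplx.exists_hol_add_conj_hol z.1
  obtain ⟨p₂, q₂, h₂⟩ := Cplx.exists_hol_add_conj_hol z.2
  exact ⟨(p₁, p₂), (q₁, q₂), Prod.ext h₁ h₂⟩

namespace HolLieAlgebroid

variable [IsManifold 𝓘(ℂ, CModel n) ω M] (L : HolLieAlgebroid n m M E)

variable (u) in
/-- The linear map `(e, v) ↦ ρ(e) - π_* v` whose kernel is the fibre of the prolongation. -/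
def anchorDefect : HolFibre n m E u →ₗ[ℂ] TangentSpace 𝓘(ℂ, CModel n) u.proj :=
  (L.anchor u.proj).comp (LinearMap.fst ℂ _ _) - (projDeriv n m E u).comp (LinearMap.snd ℂ _ _)

theorem mem_prolongation_holFibre_add_conj {p q : HolFibre n m E u} :
    holFibreₗ p + conjFibreₗ (holFibreₗ q) ∈ L.prolongation u
      ↔ L.anchorDefect u p = 0 ∧ L.anchorDefect u q = 0 := by
  have hdefect : Cplx.map ((L.anchor u.proj).restrictScalars ℝ)
        (Cplx.hol p.1 + (Cplx.hol q.1).conj)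
      - Cplx.map ((projDeriv n m E u).restrictScalars ℝ) (Cplx.hol p.2 + (Cplx.hol q.2).conj)
      = Cplx.hol (L.anchorDefect u p) + (Cplx.hol (L.anchorDefect u q)).conj := by
    have hsub : ∀ v w : TangentSpace 𝓘(ℂ, CModel n) u.proj,
        Cplx.hol (v - w) = Cplx.hol v - Cplx.hol w := map_sub Cplx.holₗ
    have hconj : ∀ v w : Cplx (TangentSpace 𝓘(ℂ, CModel n) u.proj),
        (v - w).conj = v.conj - w.conj := map_sub Cplx.conjₗ
    rw [map_add, map_add, Cplx.map_conj, Cplx.map_conj, Cplx.map_hol, Cplx.map_hol, Cplx.map_hol,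
      Cplx.map_hol, add_sub_add_comm, ← hsub, ← hconj, ← hsub]
    rfl
  refine (LinearMap.mem_ker.trans (Eq.congr_left hdefect)).trans
    ⟨Cplx.eq_zero_of_hol_add_conj_hol, ?_⟩
  rintro ⟨hp, hq⟩
  rw [hp, hq]
  exact (congrArg₂ (· + Cplx.conj ·) (map_zero Cplx.holₗ) (map_zero Cplx.holₗ)).trans
    ((zero_add _).trans (map_zero Cplx.conjₗ))

variable (u) in
theorem prolongation_eq_sup :
    L.prolongation u = (L.anchorDefect u).ker.map holFibreₗ
      ⊔ (L.anchorDefect u).ker.map (conjFibreₗ.comp holFibreₗ) := by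
  apply le_antisymm
  · intro z hz
    obtain ⟨p, q, rfl⟩ := exists_holFibre_add_conj z
    obtain ⟨hp, hq⟩ := L.mem_prolongation_holFibre_add_conj.1 hz
    exact Submodule.add_mem_sup ⟨p, hp, rfl⟩ ⟨q, hq, rfl⟩
  · refine sup_le ?_ ?_
    · rintro _ ⟨p, hp, rfl⟩
      simpa only [map_zero, add_zero] using
        L.mem_prolongation_holFibre_add_conj.2 ⟨hp, map_zero (L.anchorDefect u)⟩
    · rintro _ ⟨q, hq, rfl⟩
      simpa only [map_zero, zero_add, LinearMap.comp_apply] using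
        L.mem_prolongation_holFibre_add_conj.2 ⟨map_zero (L.anchorDefect u), hq⟩

end HolLieAlgebroid

end Prolongation

theorem contMDiffAt_mfderiv_vectorField {𝕜 V H N F : Type*} [NontriviallyNormedField 𝕜]
    [NormedAddCommGroup V] [NormedSpace 𝕜 V] [TopologicalSpace H] {I : ModelWithCorners 𝕜 V H}
    [TopologicalSpace N] [ChartedSpace H N] [IsManifold I ω N] [NormedAddCommGroup F]
    [NormedSpace 𝕜 F] {f : N → F} {X : ∀ x, TangentSpace I x} {x : N}
    (hf : ContMDiffAt I 𝓘(𝕜, F) ω f x)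
    (hX : ContMDiffAt I I.tangent ω (fun y => (⟨y, X y⟩ : TangentBundle I N)) x) :
    ContMDiffAt I 𝓘(𝕜, F) ω (fun y => (mfderiv I 𝓘(𝕜, F) f y (X y) : F)) x := by
  obtain ⟨U, hU, hUo, hxU⟩ := eventually_nhds_iff.1
    ((contMDiffAt_iff_contMDiffAt_nhds (by simp)).1 hf)
  have hfU : ContMDiffOn I 𝓘(𝕜, F) ω f U := fun y hy => (hU y hy).contMDiffWithinAt
  have htangent := (hfU.contMDiffOn_tangentMapWithin (m := ω) le_top hUo.uniqueMDiffOn).contMDiffAt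
    ((FiberBundle.continuous_proj V (TangentSpace I (M := N))).continuousAt.preimage_mem_nhds
      (hUo.mem_nhds (show (⟨x, X x⟩ : TangentBundle I N).proj ∈ U from hxU)))
  have hsnd := (contMDiff_snd_tangentBundle_modelSpace (n := ω) F 𝓘(𝕜, F)).contMDiffAt.comp x
    (htangent.comp x hX)
  refine hsnd.congr_of_eventuallyEq ?_
  filter_upwards [hUo.eventually_mem hxU] with y hy
  rw [← mfderivWithin_of_isOpen hUo hy]
  rfl

theorem mfderiv_pi_apply {𝕜 V H N ι : Type*} [NontriviallyNormedField 𝕜] [Fintype ι]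
    [NormedAddCommGroup V] [NormedSpace 𝕜 V] [TopologicalSpace H] {I : ModelWithCorners 𝕜 V H}
    [TopologicalSpace N] [ChartedSpace H N] {f : N → ι → 𝕜} {x : N}
    (hf : MDifferentiableAt I 𝓘(𝕜, ι → 𝕜) f x) (i : ι) (v : TangentSpace I x) :
    mfderiv I 𝓘(𝕜) (fun y => f y i) x v = (mfderiv I 𝓘(𝕜, ι → 𝕜) f x v : ι → 𝕜) i :=
  DFunLike.congr_fun (HasMFDerivAt.comp x (ContinuousLinearMap.proj (R := 𝕜)
    (φ := fun _ : ι => 𝕜) i).hasFDerivAt.hasMFDerivAt hf.hasMFDerivAt).mfderiv v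

section Sections

variable {n m : ℕ} {M : Type*} [TopologicalSpace M] [ChartedSpace (CModel n) M]
  {E : M → Type*} [TopologicalSpace (TotalSpace (CModel m) E)]
  [∀ x, TopologicalSpace (E x)] [FiberBundle (CModel m) E]

variable (m) in
/-- The coordinates of the section `s` in the distinguished trivialization around `b`. -/
abbrev sectionCoord (b : M) (s : ∀ x, E x) (x : M) : CModel m :=
  (trivializationAt (CModel m) E b ⟨x, s x⟩).2

variable (m E) in
theorem eventually_mem_baseSet_trivializationAt (b : M) :
    ∀ᶠ y in 𝓝 b, y ∈ (trivializationAt (CModel m) E b).baseSet :=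
  (trivializationAt (CModel m) E b).open_baseSet.eventually_mem
    (mem_baseSet_trivializationAt (CModel m) E b)

theorem eventually_proj {u : TotalSpace (CModel m) E} {p : M → Prop}
    (h : ∀ᶠ x in 𝓝 u.proj, p x) : ∀ᶠ w : TotalSpace (CModel m) E in 𝓝 u, p w.proj :=
  (FiberBundle.continuous_proj (CModel m) E).continuousAt.eventually h

variable [∀ x, AddCommGroup (E x)]

variable (E) in
/-- The section of `E` with constant coordinates `a` in the distinguished trivialization
around `b`. -/
abbrev constSection (b : M) (a : CModel m) (x : M) : E x :=
  (trivializationAt (CModel m) E b).symm x a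

section

variable {b x : M} (hx : x ∈ (trivializationAt (CModel m) E b).baseSet)
include hx

theorem sectionCoord_constSection (a : CModel m) :
    sectionCoord m b (constSection E b a) x = a :=
  congrArg Prod.snd ((trivializationAt (CModel m) E b).apply_mk_symm hx a)

theorem constSection_sectionCoord (s : ∀ x, E x) :
    constSection E b (sectionCoord m b s x) x = s x :=
  (trivializationAt (CModel m) E b).symm_apply_apply_mk hx (s x)

variable [∀ x, Module ℂ (E x)] [VectorBundle ℂ (CModel m) E]

theorem trivializationAt_snd_eq (v : E x) :
    (trivializationAt (CModel m) E b ⟨x, v⟩).2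
      = (trivializationAt (CModel m) E b).linearMapAt ℂ x v :=
  (congrFun ((trivializationAt (CModel m) E b).coe_linearMapAt_of_mem (R := ℂ) hx) v).symm

theorem constSection_eq_symmₗ (a : CModel m) :
    constSection E b a x = (trivializationAt (CModel m) E b).symmₗ ℂ x a := by
  rw [Trivialization.coe_symmₗ _ hx]

theorem constSection_eq_sum (a : CModel m) :
    constSection E b a x = ∑ γ, a γ • constSection E b (Pi.single γ 1) x := by
  simp only [constSection_eq_symmₗ hx, ← map_smul, ← map_sum]
  rw [← pi_eq_sum_univ' a]

end

variable (E) in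
theorem sectionCoord_constSection_eventuallyEq (b : M) (a : CModel m) :
    sectionCoord m b (constSection E b a) =ᶠ[𝓝 b] fun _ => a := by
  filter_upwards [eventually_mem_baseSet_trivializationAt m E b] with y hy
  exact sectionCoord_constSection hy a

theorem eventually_eq_sum_constSection [∀ x, Module ℂ (E x)] [VectorBundle ℂ (CModel m) E]
    (s : ∀ x, E x) (b : M) :
    ∀ᶠ y in 𝓝 b, s y = ∑ γ, sectionCoord m b s y γ • constSection E b (Pi.single γ 1) y := by
  filter_upwards [eventually_mem_baseSet_trivializationAt m E b] with y hy
  rw [← constSection_eq_sum hy, constSection_sectionCoord hy]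

end Sections

section HolomorphicSections

variable {n m : ℕ} {M : Type*} [TopologicalSpace M] [ChartedSpace (CModel n) M]
  {E : M → Type*} [TopologicalSpace (TotalSpace (CModel m) E)]
  [∀ x, AddCommGroup (E x)] [∀ x, Module ℂ (E x)] [∀ x, TopologicalSpace (E x)]
  [FiberBundle (CModel m) E] [VectorBundle ℂ (CModel m) E]

theorem IsHolAt.fun_smul {f : M → ℂ} {s : ∀ x, E x} {x : M}
    (hf : ContMDiffAt 𝓘(ℂ, CModel n) 𝓘(ℂ) ω f x) (hs : IsHolAt n m s x) :
    IsHolAt n m (fun y => f y • s y) x :=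
  ContMDiffAt.smul_section hf hs

theorem IsHolAt.sum {ι : Type*} (S : Finset ι) {s : ι → ∀ x, E x} {x : M}
    (hs : ∀ i, IsHolAt n m (s i) x) : IsHolAt n m (fun y => ∑ i ∈ S, s i y) x :=
  ContMDiffAt.sum_section fun i _ => hs i

variable (E) in
theorem isHolAt_zero (x : M) : IsHolAt n m (0 : ∀ x, E x) x :=
  (contMDiff_zeroSection ℂ E).contMDiffAt

variable [ContMDiffVectorBundle ω (CModel m) E 𝓘(ℂ, CModel n)]

theorem IsHolAt.trivialization_snd {s : ∀ x, E x} {b x : M} (hs : IsHolAt n m s x)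
    (hx : x ∈ (trivializationAt (CModel m) E b).baseSet) :
    ContMDiffAt 𝓘(ℂ, CModel n) 𝓘(ℂ, CModel m) ω (sectionCoord m b s) x :=
  ((trivializationAt (CModel m) E b).contMDiffAt_section_iff hx).1 hs

theorem isHolAt_constSection (b : M) (a : CModel m) : IsHolAt n m (constSection E b a) b :=
  ((trivializationAt (CModel m) E b).contMDiffAt_section_iff
    (mem_baseSet_trivializationAt (CModel m) E b)).2
    (contMDiffAt_const.congr_of_eventuallyEq (sectionCoord_constSection_eventuallyEq E b a))

theorem IsHolAt.eventually [IsManifold 𝓘(ℂ, CModel n) ω M] {s : ∀ x, E x} {x : M}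
    (hs : IsHolAt n m s x) : ∀ᶠ y in 𝓝 x, IsHolAt n m s y :=
  (contMDiffAt_iff_contMDiffAt_nhds (by simp)).1 hs

end HolomorphicSections

namespace HolLieAlgebroid

variable {n m : ℕ} {M : Type*} [TopologicalSpace M] [ChartedSpace (CModel n) M]
  [IsManifold 𝓘(ℂ, CModel n) ω M] {E : M → Type*} [TopologicalSpace (TotalSpace (CModel m) E)]
  [∀ x, AddCommGroup (E x)] [∀ x, Module ℂ (E x)] [∀ x, TopologicalSpace (E x)]
  [FiberBundle (CModel m) E] (L : HolLieAlgebroid n m M E)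
  {F : Type*} [NormedAddCommGroup F] [NormedSpace ℂ F] {s t r : ∀ x, E x} {x : M}

/-- The derivative `ρ(s)(f)` of a vector valued function `f` on `M` along the anchor of a section
`s` of `E`. -/
def anchorDeriv (s : ∀ x, E x) (f : M → F) (x : M) : F :=
  mfderiv 𝓘(ℂ, CModel n) 𝓘(ℂ, F) f x (L.anchor x (s x))

theorem anchorDeriv_congr {s s' : ∀ x, E x} {f g : M → F} (hs : s x = s' x) (h : f =ᶠ[𝓝 x] g) :
    L.anchorDeriv s f x = L.anchorDeriv s' g x := by
  rw [anchorDeriv, anchorDeriv, hs, h.mfderiv_eq]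
  rfl

theorem anchorDeriv_const (s : ∀ x, E x) (a : F) : L.anchorDeriv s (fun _ => a) x = 0 := by
  rw [anchorDeriv, mfderiv_const]
  rfl

theorem anchorDeriv_pi_apply {ι : Type*} [Fintype ι] {f : M → ι → ℂ}
    (hf : ContMDiffAt 𝓘(ℂ, CModel n) 𝓘(ℂ, ι → ℂ) ω f x) (i : ι) :
    L.anchorDeriv s (fun y => f y i) x = L.anchorDeriv s f x i :=
  mfderiv_pi_apply (hf.mdifferentiableAt (by simp)) i _

theorem contMDiffAt_anchor (hs : IsHolAt n m s x) :
    ContMDiffAt 𝓘(ℂ, CModel n) 𝓘(ℂ, CModel n).tangent ω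
      (fun y => (⟨y, L.anchor y (s y)⟩ : TangentBundle 𝓘(ℂ, CModel n) M)) x :=
  L.anchor_hol.contMDiffAt.comp x hs

theorem contMDiffAt_anchorDeriv {f : M → F} (hs : IsHolAt n m s x)
    (hf : ContMDiffAt 𝓘(ℂ, CModel n) 𝓘(ℂ, F) ω f x) :
    ContMDiffAt 𝓘(ℂ, CModel n) 𝓘(ℂ, F) ω (L.anchorDeriv s f) x :=
  contMDiffAt_mfderiv_vectorField hf (L.contMDiffAt_anchor hs)

theorem bracket_congr_right {t' : ∀ x, E x} (hs : IsHolAt n m s x) (ht : IsHolAt n m t x)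
    (h : ∀ᶠ y in 𝓝 x, t y = t' y) : L.bracket s t x = L.bracket s t' x :=
  L.bracket_congr s s t t' x hs ht (Eventually.of_forall fun _ => rfl) h

theorem bracket_fun_smul {f : M → ℂ} (hf : ContMDiffAt 𝓘(ℂ, CModel n) 𝓘(ℂ) ω f x)
    (hs : IsHolAt n m s x) (ht : IsHolAt n m t x) :
    L.bracket s (fun y => f y • t y) x = f x • L.bracket s t x + L.anchorDeriv s f x • t x :=
  L.leibniz f s t x hf hs ht

theorem constSection_constBracket (b : M) (a a' : CModel m) :
    constSection E b (L.constBracket b a a') b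
      = L.bracket (constSection E b a) (constSection E b a') b :=
  constSection_sectionCoord (mem_baseSet_trivializationAt (CModel m) E b) (L.bracket _ _)

variable [VectorBundle ℂ (CModel m) E]

theorem bracket_zero_right (hs : IsHolAt n m s x) : L.bracket s 0 x = 0 := by
  have h := L.bracket_smul 0 s 0 x hs (isHolAt_zero E x)
  rwa [zero_smul, zero_smul] at h

theorem bracket_sum {ι : Type*} (S : Finset ι) {t : ι → ∀ x, E x} (hs : IsHolAt n m s x)
    (ht : ∀ i, IsHolAt n m (t i) x) :
    L.bracket s (fun y => ∑ i ∈ S, t i y) x = ∑ i ∈ S, L.bracket s (t i) x := by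
  classical
  induction S using Finset.induction_on with
  | empty => exact L.bracket_zero_right hs
  | insert i S hi ih =>
    simp only [Finset.sum_insert hi]
    rw [← ih, ← L.bracket_add _ _ _ _ hs (ht i) (IsHolAt.sum S ht)]
    rfl

variable [ContMDiffVectorBundle ω (CModel m) E 𝓘(ℂ, CModel n)]

theorem bracket_bracket_swap (hs : IsHolAt n m s x) (ht : IsHolAt n m t x)
    (hr : IsHolAt n m r x) : L.bracket s (L.bracket t r) x = -L.bracket s (L.bracket r t) x := by
  have hswap : ∀ᶠ y in 𝓝 x, L.bracket t r y = ((-1 : ℂ) • L.bracket r t) y := by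
    filter_upwards [ht.eventually, hr.eventually] with y hty hry
    rw [L.bracket_skew _ _ _ hty hry, Pi.smul_apply, neg_one_smul]
  rw [L.bracket_congr_right hs (L.bracket_hol _ _ _ ht hr) hswap,
    L.bracket_smul _ _ _ _ hs (L.bracket_hol _ _ _ hr ht), neg_one_smul]

theorem bracket_bracket_fun_smul {f : M → ℂ} (hf : ContMDiffAt 𝓘(ℂ, CModel n) 𝓘(ℂ) ω f x)
    (hs : IsHolAt n m s x) (ht : IsHolAt n m t x) (hr : IsHolAt n m r x) :
    L.bracket s (L.bracket t fun y => f y • r y) x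
      = (f x • L.bracket s (L.bracket t r) x + L.anchorDeriv s f x • L.bracket t r x)
        + (L.anchorDeriv t f x • L.bracket s r x
          + L.anchorDeriv s (L.anchorDeriv t f) x • r x) := by
  have htr := L.bracket_hol _ _ _ ht hr
  have htf := L.contMDiffAt_anchorDeriv ht hf
  have hleibniz : ∀ᶠ y in 𝓝 x, L.bracket t (fun y => f y • r y) y
      = ((fun y => f y • L.bracket t r y) + fun y => L.anchorDeriv t f y • r y : ∀ x, E x) y := by
    filter_upwards [(contMDiffAt_iff_contMDiffAt_nhds (by simp)).1 hf, ht.eventually,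
      hr.eventually] with y hfy hty hry
    exact L.bracket_fun_smul hfy hty hry
  rw [L.bracket_congr_right hs (L.bracket_hol _ _ _ ht (hr.fun_smul hf)) hleibniz,
    L.bracket_add _ _ _ _ hs (htr.fun_smul hf) (hr.fun_smul htf),
    L.bracket_fun_smul hf hs htr, L.bracket_fun_smul htf hs hr]

/- Substituting `f r` for `r` in the Jacobi identity and expanding by the Leibniz rule, every term
cancels against `f` times the Jacobi identity for `r` except the derivatives of `f` of order two. -/
theorem anchorDeriv_bracket_of_ne_zero {f : M → ℂ} (hs : IsHolAt n m s x) (ht : IsHolAt n m t x)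
    (hr : IsHolAt n m r x) (hr0 : r x ≠ 0) (hf : ContMDiffAt 𝓘(ℂ, CModel n) 𝓘(ℂ) ω f x) :
    L.anchorDeriv (L.bracket s t) f x
      = L.anchorDeriv s (L.anchorDeriv t f) x - L.anchorDeriv t (L.anchorDeriv s f) x := by
  have hst := L.bracket_hol _ _ _ hs ht
  have hfr := hr.fun_smul hf
  have jacobi_fr := L.jacobi s t (fun y => f y • r y) x hs ht hfr
  have jacobi_r := L.jacobi s t r x hs ht hr
  rw [L.bracket_bracket_fun_smul hf hs ht hr, L.bracket_bracket_swap ht hfr hs,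
    L.bracket_bracket_fun_smul hf ht hs hr, L.bracket_skew _ _ _ hfr hst,
    L.bracket_fun_smul hf hst hr] at jacobi_fr
  rw [L.bracket_bracket_swap ht hr hs, L.bracket_skew _ _ _ hr hst] at jacobi_r
  have hcancel : (L.anchorDeriv s (L.anchorDeriv t f) x - L.anchorDeriv t (L.anchorDeriv s f) x
      - L.anchorDeriv (L.bracket s t) f x) • r x = 0 := by
    linear_combination (norm := module) jacobi_fr - f x • jacobi_r
  exact (sub_eq_zero.1 ((smul_eq_zero.1 hcancel).resolve_right hr0)).symm

theorem anchorDeriv_pi_bracket_of_ne_zero {ι : Type*} [Fintype ι] {f : M → ι → ℂ}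
    (hs : IsHolAt n m s x) (ht : IsHolAt n m t x) (hr : IsHolAt n m r x) (hr0 : r x ≠ 0)
    (hf : ContMDiffAt 𝓘(ℂ, CModel n) 𝓘(ℂ, ι → ℂ) ω f x) :
    L.anchorDeriv (L.bracket s t) f x
      = L.anchorDeriv s (L.anchorDeriv t f) x - L.anchorDeriv t (L.anchorDeriv s f) x := by
  have hsecond : ∀ {p q : ∀ x, E x}, IsHolAt n m q x → ∀ i,
      L.anchorDeriv p (L.anchorDeriv q fun y => f y i) x
        = L.anchorDeriv p (L.anchorDeriv q f) x i := by
    intro p q hq i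
    rw [← L.anchorDeriv_pi_apply (L.contMDiffAt_anchorDeriv hq hf)]
    refine L.anchorDeriv_congr rfl ?_
    filter_upwards [(contMDiffAt_iff_contMDiffAt_nhds (by simp)).1 hf] with y hy
    exact L.anchorDeriv_pi_apply hy i
  ext i
  rw [Pi.sub_apply, ← hsecond ht, ← hsecond hs, ← L.anchorDeriv_pi_apply hf]
  exact L.anchorDeriv_bracket_of_ne_zero hs ht hr hr0 (contMDiffAt_pi_space.1 hf i)

theorem bracket_eq_sum {b : M} (hs : IsHolAt n m s b) (ht : IsHolAt n m t b) :
    L.bracket s t b = ∑ γ, sectionCoord m b t b γ • L.bracket s (constSection E b (Pi.single γ 1)) b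
      + constSection E b (L.anchorDeriv s (sectionCoord m b t) b) b := by
  have hb := mem_baseSet_trivializationAt (CModel m) E b
  have hcoord := ht.trivialization_snd hb
  have hε := fun γ => isHolAt_constSection (n := n) (E := E) b (Pi.single γ 1 : CModel m)
  rw [L.bracket_congr_right hs ht (eventually_eq_sum_constSection (m := m) t b),
    L.bracket_sum _ hs fun γ => (hε γ).fun_smul (contMDiffAt_pi_space.1 hcoord γ),
    constSection_eq_sum hb (L.anchorDeriv _ _ _), ← Finset.sum_add_distrib]
  refine Finset.sum_congr rfl fun γ _ => ?_
  rw [L.bracket_fun_smul (contMDiffAt_pi_space.1 hcoord γ) hs (hε γ),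
    L.anchorDeriv_pi_apply hcoord]

theorem bracket_eq_bracket_constSection_right {b : M} (hs : IsHolAt n m s b)
    (ht : IsHolAt n m t b) :
    L.bracket s t b = L.bracket s (constSection E b (sectionCoord m b t b)) b
      + constSection E b (L.anchorDeriv s (sectionCoord m b t) b) b := by
  have hb := mem_baseSet_trivializationAt (CModel m) E b
  rw [L.bracket_eq_sum hs ht, L.bracket_eq_sum hs (isHolAt_constSection b _),
    sectionCoord_constSection hb, L.anchorDeriv_congr (s' := s) rfl
      (sectionCoord_constSection_eventuallyEq E b (sectionCoord m b t b)),
    L.anchorDeriv_const, constSection_eq_symmₗ hb 0, map_zero, add_zero]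

theorem bracket_eq_bracket_constSection {b : M} (hs : IsHolAt n m s b) (ht : IsHolAt n m t b) :
    L.bracket s t b = L.bracket (constSection E b (sectionCoord m b s b))
        (constSection E b (sectionCoord m b t b)) b
      + constSection E b (L.anchorDeriv s (sectionCoord m b t) b) b
      - constSection E b (L.anchorDeriv t (sectionCoord m b s) b) b := by
  have hε := isHolAt_constSection (n := n) (E := E) b (sectionCoord m b s b)
  have hself : constSection E b (sectionCoord m b s b) b = s b :=
    constSection_sectionCoord (mem_baseSet_trivializationAt (CModel m) E b) s
  rw [L.bracket_skew _ _ _ hs ht, L.bracket_eq_bracket_constSection_right ht hs, neg_add,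
    ← L.bracket_skew _ _ _ hε ht, L.bracket_eq_bracket_constSection_right hε ht,
    L.anchorDeriv_congr hself EventuallyEq.rfl, ← sub_eq_add_neg]

theorem bracket_eq_constBracket {b : M} (hs : IsHolAt n m s b) (ht : IsHolAt n m t b) :
    L.bracket s t b = constSection E b
      (L.anchorDeriv s (sectionCoord m b t) b - L.anchorDeriv t (sectionCoord m b s) b
        + L.constBracket b (sectionCoord m b s b) (sectionCoord m b t b)) b := by
  have hb := mem_baseSet_trivializationAt (CModel m) E b
  rw [constSection_eq_symmₗ hb, map_add, map_sub, ← constSection_eq_symmₗ hb,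
    ← constSection_eq_symmₗ hb, ← constSection_eq_symmₗ hb, L.constSection_constBracket,
    L.bracket_eq_bracket_constSection hs ht]
  abel

theorem constBracket_skew (b : M) (a a' : CModel m) :
    L.constBracket b a a' = -L.constBracket b a' a := by
  have hb := mem_baseSet_trivializationAt (CModel m) E b
  rw [constBracket, constBracket, trivializationAt_snd_eq hb, trivializationAt_snd_eq hb,
    L.bracket_skew _ _ _ (isHolAt_constSection b a) (isHolAt_constSection b a'), map_neg]

theorem constBracket_smul_right (b : M) (c : ℂ) (a a' : CModel m) :
    L.constBracket b a (c • a') = c • L.constBracket b a a' := by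
  have hb := mem_baseSet_trivializationAt (CModel m) E b
  have hε := isHolAt_constSection (n := n) (m := m) (E := E) b
  have hsmul : ∀ᶠ y in 𝓝 b, constSection E b (c • a') y = (c • constSection E b a') y := by
    filter_upwards [eventually_mem_baseSet_trivializationAt m E b] with y hy
    rw [constSection_eq_symmₗ hy, map_smul, ← constSection_eq_symmₗ hy]
    rfl
  rw [constBracket, constBracket, trivializationAt_snd_eq hb, trivializationAt_snd_eq hb,
    L.bracket_congr_right (hε a) (hε (c • a')) hsmul, L.bracket_smul _ _ _ _ (hε a) (hε a'),
    map_smul]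

theorem constBracket_smul_smul (b : M) (c d : ℂ) (a a' : CModel m) :
    L.constBracket b (c • a) (d • a') = (c * d) • L.constBracket b a a' := by
  rw [L.constBracket_smul_right, L.constBracket_skew, L.constBracket_smul_right,
    L.constBracket_skew b a' a]
  module

end HolLieAlgebroid

section Coordinates

variable {n m : ℕ} {M : Type*} [TopologicalSpace M] [ChartedSpace (CModel n) M]
  {E : M → Type*} [TopologicalSpace (TotalSpace (CModel m) E)]
  [∀ x, AddCommGroup (E x)] [∀ x, Module ℂ (E x)] [∀ x, TopologicalSpace (E x)]
  [FiberBundle (CModel m) E] {e : Fin m → ∀ x, E x} {b x : M}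

variable (e) in
/-- The linear map which takes the coordinates of a vector of `E x` in the frame `e` to its
coordinates in the distinguished trivialization around `b`. -/
def frameMap (b x : M) : CModel m →L[ℂ] CModel m :=
  ∑ α, (ContinuousLinearMap.proj (R := ℂ) (φ := fun _ : Fin m => ℂ) α).smulRight
    (sectionCoord m b (e α) x)

section

variable {U : Set M} (he : IsLocalFrameOn 𝓘(ℂ, CModel n) (CModel m) ω e U) (hx : x ∈ U)
include hx

theorem coeff_eq_repr_toBasisAt (v : E x) (α : Fin m) :
    he.coeff α x v = (he.toBasisAt hx).repr v α := by
  rw [IsLocalFrameOn.coeff, dif_pos hx, Module.Basis.coord_apply]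

theorem sum_coeff_smul_frame (v : E x) : ∑ α, he.coeff α x v • e α x = v := by
  simp only [coeff_eq_repr_toBasisAt he hx, ← he.toBasisAt_coe hx]
  exact (he.toBasisAt hx).sum_repr v

theorem coeff_sum_smul_frame (a : Fin m → ℂ) (α : Fin m) :
    he.coeff α x (∑ β, a β • e β x) = a α := by
  simp only [coeff_eq_repr_toBasisAt he hx, ← he.toBasisAt_coe hx, Module.Basis.repr_sum_self]

end

section

variable [VectorBundle ℂ (CModel m) E]

theorem frameMap_apply (hxb : x ∈ (trivializationAt (CModel m) E b).baseSet) (a : CModel m) :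
    frameMap e b x a = (trivializationAt (CModel m) E b ⟨x, ∑ α, a α • e α x⟩).2 := by
  simp [frameMap, sectionCoord, trivializationAt_snd_eq hxb]

theorem isInvertible_frameMap (hxb : x ∈ (trivializationAt (CModel m) E b).baseSet)
    (he : LinearIndependent ℂ fun α => e α x) : (frameMap e b x).IsInvertible := by
  have hinj : Function.Injective (frameMap e b x : CModel m →ₗ[ℂ] CModel m) := by
    rw [← LinearMap.ker_eq_bot, LinearMap.ker_eq_bot']
    intro a ha
    have hsum : (trivializationAt (CModel m) E b).linearEquivAt ℂ x hxb (∑ α, a α • e α x) = 0 :=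
      (frameMap_apply hxb a).symm.trans ha
    exact funext (Fintype.linearIndependent_iff.1 he a ((LinearEquiv.map_eq_zero_iff _).1 hsum))
  exact ⟨(LinearEquiv.ofInjectiveEndo _ hinj).toContinuousLinearEquiv, by ext1; rfl⟩

variable [ContMDiffVectorBundle ω (CModel m) E 𝓘(ℂ, CModel n)]

theorem contMDiffAt_frameMap (he : ∀ α, IsHolAt n m (e α) x)
    (hxb : x ∈ (trivializationAt (CModel m) E b).baseSet) :
    ContMDiffAt 𝓘(ℂ, CModel n) 𝓘(ℂ, CModel m →L[ℂ] CModel m) ω (frameMap e b) x := by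
  refine ContMDiffAt.sum fun α _ => ?_
  exact (ContinuousLinearMap.smulRightL ℂ (CModel m) (CModel m)
    (ContinuousLinearMap.proj α)).contMDiff.contMDiffAt.comp x ((he α).trivialization_snd hxb)

end

variable {φ : OpenPartialHomeomorph M (CModel n)}

theorem bundleParam_bundleCoord (he : IsLocalFrameOn 𝓘(ℂ, CModel n) (CModel m) ω e φ.source)
    {u : TotalSpace (CModel m) E} (hu : u.proj ∈ φ.source) :
    bundleParam φ e (bundleCoord he u) = u := by
  have heq : ∀ y, y = u.proj →
      (⟨y, ∑ α, he.coeff α u.proj u.2 • e α y⟩ : TotalSpace (CModel m) E) = u := by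
    rintro _ rfl
    rw [sum_coeff_smul_frame he hu]
  exact heq _ (φ.left_inv hu)

theorem bundleCoord_bundleParam (he : IsLocalFrameOn 𝓘(ℂ, CModel n) (CModel m) ω e φ.source)
    {p : CModel n × CModel m} (hp : p.1 ∈ φ.target) :
    bundleCoord he (bundleParam φ e p) = p :=
  Prod.ext (φ.right_inv hp) (funext (coeff_sum_smul_frame he (φ.map_target hp) p.2))

variable [VectorBundle ℂ (CModel m) E] [ContMDiffVectorBundle ω (CModel m) E 𝓘(ℂ, CModel n)]
  (hφ : φ ∈ IsManifold.maximalAtlas 𝓘(ℂ, CModel n) ω M)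
  (he : IsLocalFrameOn 𝓘(ℂ, CModel n) (CModel m) ω e φ.source)
include hφ he

theorem contMDiffAt_bundleParam {p : CModel n × CModel m} (hp : p.1 ∈ φ.target) :
    ContMDiffAt 𝓘(ℂ, CModel n × CModel m) (totalModelC n m) ω (bundleParam φ e) p := by
  have hbase : ContMDiffAt 𝓘(ℂ, CModel n × CModel m) 𝓘(ℂ, CModel n) ω
      (fun q : CModel n × CModel m => φ.symm q.1) p :=
    (contMDiffAt_symm_of_mem_maximalAtlas hφ hp).comp p contDiffAt_fst.contMDiffAt
  have hmem := mem_baseSet_trivializationAt (CModel m) E (φ.symm p.1)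
  have hmap := contMDiffAt_frameMap (b := φ.symm p.1)
    (fun α => he.contMDiffAt φ.open_source (φ.map_target hp) α) hmem
  refine contMDiffAt_totalSpace.2 ⟨hbase, ?_⟩
  refine ((hmap.comp p hbase).clm_apply contDiffAt_snd.contMDiffAt).congr_of_eventuallyEq ?_
  filter_upwards [hbase.continuousAt.eventually
    (eventually_mem_baseSet_trivializationAt m E (φ.symm p.1))] with q hq
  exact (frameMap_apply hq q.2).symm

theorem contMDiffAt_bundleCoord {u : TotalSpace (CModel m) E} (hu : u.proj ∈ φ.source) :
    ContMDiffAt (totalModelC n m) 𝓘(ℂ, CModel n × CModel m) ω (bundleCoord he) u := by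
  have hmem := mem_baseSet_trivializationAt (CModel m) E u.proj
  have hproj : ContMDiffAt (totalModelC n m) 𝓘(ℂ, CModel n) ω
      (fun w : TotalSpace (CModel m) E => w.proj) u := contMDiffAt_proj E
  have hmap := contMDiffAt_frameMap (b := u.proj) (he.contMDiffAt φ.open_source hu) hmem
  have hinv := isInvertible_frameMap hmem (he.linearIndependent hu)
  have hfibre := (hinv.contDiffAt_map_inverse.contMDiffAt.comp u (hmap.comp u hproj)).clm_apply
    (contMDiffAt_totalSpace.1 contMDiffAt_id).2
  refine (((contMDiffAt_of_mem_maximalAtlas hφ hu).comp u hproj).prodMk_space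
    hfibre).congr_of_eventuallyEq ?_
  filter_upwards [eventually_proj (φ.open_source.eventually_mem hu),
    eventually_proj (eventually_mem_baseSet_trivializationAt m E u.proj),
    (hmap.comp u hproj).continuousAt.eventually (ContinuousLinearEquiv.isOpen.mem_nhds hinv)]
    with w hw hwb hwi
  refine Prod.ext rfl (ContinuousLinearMap.IsInvertible.inverse_apply_eq hwi |>.2 ?_).symm
  change _ = frameMap e u.proj w.proj fun α => he.coeff α w.proj w.2
  rw [frameMap_apply hwb, sum_coeff_smul_frame he hw]
  rfl

end Coordinates

theorem mfderiv_comp_mfderiv_of_eventually_leftInverse {𝕜 V H N V' H' N' : Type*}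
    [NontriviallyNormedField 𝕜] [NormedAddCommGroup V] [NormedSpace 𝕜 V] [TopologicalSpace H]
    {I : ModelWithCorners 𝕜 V H} [TopologicalSpace N] [ChartedSpace H N]
    [NormedAddCommGroup V'] [NormedSpace 𝕜 V'] [TopologicalSpace H']
    {I' : ModelWithCorners 𝕜 V' H'} [TopologicalSpace N'] [ChartedSpace H' N']
    {f : N → N'} {g : N' → N} {x : N} (hg : MDifferentiableAt I' I g (f x))
    (hf : MDifferentiableAt I I' f x) (h : g ∘ f =ᶠ[𝓝 x] id) :
    (mfderiv I' I g (f x) : V' →L[𝕜] V).comp (mfderiv I I' f x : V →L[𝕜] V')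
      = ContinuousLinearMap.id 𝕜 V := by
  have hcomp := h.mfderiv_eq (I := I) (I' := I)
  rw [mfderiv_comp x hg hf, mfderiv_id] at hcomp
  exact hcomp

theorem mlieBracket_eq_lieBracket {𝕜 V : Type*} [NontriviallyNormedField 𝕜]
    [NormedAddCommGroup V] [NormedSpace 𝕜 V] {X Y : ∀ x : V, TangentSpace 𝓘(𝕜, V) x} :
    VectorField.mlieBracket 𝓘(𝕜, V) X Y = VectorField.lieBracket 𝕜 X Y := by
  rw [← VectorField.mlieBracketWithin_univ, VectorField.mlieBracketWithin_eq_lieBracketWithin]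
  exact VectorField.lieBracketWithin_univ

section CoordinateFields

variable {n m : ℕ} {M : Type*} [TopologicalSpace M] [ChartedSpace (CModel n) M]
  {E : M → Type*} [TopologicalSpace (TotalSpace (CModel m) E)]
  [∀ x, AddCommGroup (E x)] [∀ x, Module ℂ (E x)] [∀ x, TopologicalSpace (E x)]
  [FiberBundle (CModel m) E] {φ : OpenPartialHomeomorph M (CModel n)} {e : Fin m → ∀ x, E x}

/-- The holomorphic tangent vector of `E` at `u` with given components in the coordinates
`(z^k, u^α)`. -/
def coordVec (he : IsLocalFrameOn 𝓘(ℂ, CModel n) (CModel m) ω e φ.source)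
    (u : TotalSpace (CModel m) E) :
    (CModel n × CModel m) →L[ℂ] TangentSpace (totalModelC n m) u :=
  mfderiv 𝓘(ℂ, CModel n × CModel m) (totalModelC n m) (bundleParam φ e) (bundleCoord he u)

/-- The vertical tangent vector `a^α ∂/∂u^α` of `E` at `u`. -/
def verticalVec (he : IsLocalFrameOn 𝓘(ℂ, CModel n) (CModel m) ω e φ.source)
    (u : TotalSpace (CModel m) E) : CModel m →ₗ[ℂ] TangentSpace (totalModelC n m) u :=
  (coordVec he u).toLinearMap.comp (LinearMap.inr ℂ (CModel n) (CModel m))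

/-- The vector field on `E` with component functions `x` in the coordinates `(z^k, u^α)`. -/
def coordField (he : IsLocalFrameOn 𝓘(ℂ, CModel n) (CModel m) ω e φ.source)
    (x : CModel n × CModel m → CModel n × CModel m) (u : TotalSpace (CModel m) E) :
    TangentSpace (totalModelC n m) u :=
  coordVec he u (x (bundleCoord he u))

variable [VectorBundle ℂ (CModel m) E] [ContMDiffVectorBundle ω (CModel m) E 𝓘(ℂ, CModel n)]
  (hφ : φ ∈ IsManifold.maximalAtlas 𝓘(ℂ, CModel n) ω M)
  (he : IsLocalFrameOn 𝓘(ℂ, CModel n) (CModel m) ω e φ.source)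
  {u : TotalSpace (CModel m) E} (hu : u.proj ∈ φ.source)
include hφ hu

theorem coordVec_mfderiv_bundleCoord (v : TangentSpace (totalModelC n m) u) :
    coordVec he u (mfderiv (totalModelC n m) 𝓘(ℂ, CModel n × CModel m) (bundleCoord he) u v)
      = v := by
  have hinv : bundleParam φ e ∘ bundleCoord he =ᶠ[𝓝 u] id := by
    filter_upwards [eventually_proj (φ.open_source.eventually_mem hu)] with w hw
    exact bundleParam_bundleCoord he hw
  exact DFunLike.congr_fun (mfderiv_comp_mfderiv_of_eventually_leftInverse
    ((contMDiffAt_bundleParam hφ he (φ.map_source hu)).mdifferentiableAt (by simp))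
    ((contMDiffAt_bundleCoord hφ he hu).mdifferentiableAt (by simp)) hinv) v

theorem mfderiv_bundleCoord_coordVec (p : CModel n × CModel m) :
    mfderiv (totalModelC n m) 𝓘(ℂ, CModel n × CModel m) (bundleCoord he) u (coordVec he u p)
      = p := by
  have hinv : bundleCoord he ∘ bundleParam φ e =ᶠ[𝓝 (bundleCoord he u)] id := by
    filter_upwards [continuous_fst.continuousAt.eventually
      (φ.open_target.eventually_mem (φ.map_source hu))] with p hp
    exact bundleCoord_bundleParam he hp
  have hcoord := (contMDiffAt_bundleCoord hφ he hu).mdifferentiableAt (by simp : ω ≠ 0)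
  have hcomp := mfderiv_comp_mfderiv_of_eventually_leftInverse
    (by rwa [bundleParam_bundleCoord he hu])
    ((contMDiffAt_bundleParam hφ he (φ.map_source hu)).mdifferentiableAt (by simp)) hinv
  rw [bundleParam_bundleCoord he hu] at hcomp
  exact DFunLike.congr_fun hcomp p

theorem isInvertible_mfderiv_bundleCoord :
    (mfderiv (totalModelC n m) 𝓘(ℂ, CModel n × CModel m) (bundleCoord he) u).IsInvertible :=
  ContinuousLinearMap.IsInvertible.of_inverse
    (ContinuousLinearMap.ext (mfderiv_bundleCoord_coordVec hφ he hu))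
    (ContinuousLinearMap.ext (coordVec_mfderiv_bundleCoord hφ he hu))

theorem mpullback_bundleCoord (x : CModel n × CModel m → CModel n × CModel m) :
    VectorField.mpullback (totalModelC n m) 𝓘(ℂ, CModel n × CModel m) (bundleCoord he) x u
      = coordField he x u := by
  have hinv : (mfderiv (totalModelC n m) 𝓘(ℂ, CModel n × CModel m) (bundleCoord he) u).inverse
      = coordVec he u :=
    ContinuousLinearMap.inverse_eq
      (ContinuousLinearMap.ext (mfderiv_bundleCoord_coordVec hφ he hu))
      (ContinuousLinearMap.ext (coordVec_mfderiv_bundleCoord hφ he hu))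
  exact DFunLike.congr_fun hinv (x (bundleCoord he u))

theorem coordField_eventuallyEq_mpullback (x : CModel n × CModel m → CModel n × CModel m) :
    coordField he x =ᶠ[𝓝 u]
      VectorField.mpullback (totalModelC n m) 𝓘(ℂ, CModel n × CModel m) (bundleCoord he) x := by
  filter_upwards [eventually_proj (φ.open_source.eventually_mem hu)] with w hw
  exact (mpullback_bundleCoord hφ he hw x).symm

variable [IsManifold 𝓘(ℂ, CModel n) ω M] {x y : CModel n × CModel m → CModel n × CModel m}

theorem mdifferentiableAt_coordField (hx : ContDiffAt ℂ ω x (bundleCoord he u)) :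
    MDifferentiableAt (totalModelC n m) (totalModelC n m).tangent
      (fun w => (⟨w, coordField he x w⟩ :
        TangentBundle (totalModelC n m) (TotalSpace (CModel m) E))) u := by
  have hx' := (contMDiffAt_vectorSpace_iff_contDiffAt.2 hx).mdifferentiableAt (by simp)
  refine (hx'.mpullback_vectorField (contMDiffAt_bundleCoord hφ he hu)
    (isInvertible_mfderiv_bundleCoord hφ he hu) le_top).congr_of_eventuallyEq ?_
  filter_upwards [coordField_eventuallyEq_mpullback hφ he hu x] with w hw
  rw [hw]

theorem mlieBracket_coordField (hx : ContDiffAt ℂ ω x (bundleCoord he u))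
    (hy : ContDiffAt ℂ ω y (bundleCoord he u)) :
    VectorField.mlieBracket (totalModelC n m) (coordField he x) (coordField he y) u
      = coordVec he u (fderiv ℂ y (bundleCoord he u) (x (bundleCoord he u))
          - fderiv ℂ x (bundleCoord he u) (y (bundleCoord he u))) := by
  have hx' := (contMDiffAt_vectorSpace_iff_contDiffAt.2 hx).mdifferentiableAt (by simp)
  have hy' := (contMDiffAt_vectorSpace_iff_contDiffAt.2 hy).mdifferentiableAt (by simp)
  refine ((coordField_eventuallyEq_mpullback hφ he hu x).mlieBracket_vectorField_eq
    (coordField_eventuallyEq_mpullback hφ he hu y)).trans ?_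
  refine (VectorField.mpullback_mlieBracket hx' hy' (contMDiffAt_bundleCoord hφ he hu)
    le_top).symm.trans ((mpullback_bundleCoord hφ he hu _).trans ?_)
  exact congrArg (coordVec he u) (congrFun mlieBracket_eq_lieBracket _)

end CoordinateFields

section BaseFields

variable {n m : ℕ} {M : Type*} [TopologicalSpace M] {φ : OpenPartialHomeomorph M (CModel n)}
  {r : M → CModel n} {p : CModel n × CModel m} {x : M}

variable (m φ r) in
/-- The horizontal vector field `r^k ∂/∂z^k`, with components pulled back from the base, in the
coordinates `(z^k, u^α)`. -/
def baseField (p : CModel n × CModel m) : CModel n × CModel m :=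
  (r (φ.symm p.1), 0)

theorem baseField_eq (hx : x ∈ φ.source) (hpx : p.1 = φ x) : baseField m φ r p = (r x, 0) := by
  rw [baseField, hpx, φ.left_inv hx]

variable [ChartedSpace (CModel n) M] (hφ : φ ∈ IsManifold.maximalAtlas 𝓘(ℂ, CModel n) ω M)
  (hx : x ∈ φ.source)
include hφ hx

theorem mfderiv_chart_injective :
    Function.Injective (mfderiv 𝓘(ℂ, CModel n) 𝓘(ℂ, CModel n) φ x) :=
  OpenPartialHomeomorph.MDifferentiable.mfderiv_injective
    ⟨(contMDiffOn_of_mem_maximalAtlas hφ).mdifferentiableOn (by simp),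
      (contMDiffOn_symm_of_mem_maximalAtlas hφ).mdifferentiableOn (by simp)⟩ hx

variable (hr : ContMDiffAt 𝓘(ℂ, CModel n) 𝓘(ℂ, CModel n) ω r x)
include hr

theorem contMDiffAt_comp_chart_symm :
    ContMDiffAt 𝓘(ℂ, CModel n) 𝓘(ℂ, CModel n) ω (r ∘ φ.symm) (φ x) :=
  hr.comp_of_eq (contMDiffAt_symm_of_mem_maximalAtlas hφ (φ.map_source hx)) (φ.left_inv hx)

variable (hpx : p.1 = φ x)
include hpx

theorem contDiffAt_baseField : ContDiffAt ℂ ω (baseField m φ r) p := by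
  have hsymm : ContDiffAt ℂ ω (r ∘ φ.symm) p.1 := by
    rw [hpx, ← contMDiffAt_iff_contDiffAt]
    exact contMDiffAt_comp_chart_symm hφ hx hr
  exact (hsymm.comp p contDiffAt_fst).prodMk contDiffAt_const

theorem fderiv_baseField (v : TangentSpace 𝓘(ℂ, CModel n) x) (w : CModel m) :
    fderiv ℂ (baseField m φ r) p (mfderiv 𝓘(ℂ, CModel n) 𝓘(ℂ, CModel n) φ x v, w)
      = (mfderiv 𝓘(ℂ, CModel n) 𝓘(ℂ, CModel n) r x v, 0) := by
  have hsymm := (contMDiffAt_comp_chart_symm hφ hx hr).mdifferentiableAt (by simp)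
  have hderiv : fderiv ℂ (baseField m φ r) p
      = ((fderiv ℂ (r ∘ φ.symm) p.1).comp (.fst ℂ _ _)).prod 0 :=
    (((hpx ▸ hsymm.differentiableAt : DifferentiableAt ℂ (r ∘ φ.symm) p.1).hasFDerivAt.comp p
      hasFDerivAt_fst).prodMk (hasFDerivAt_const _ _)).fderiv
  have hcomp : mfderiv 𝓘(ℂ, CModel n) 𝓘(ℂ, CModel n) ((r ∘ φ.symm) ∘ φ) x
      = mfderiv 𝓘(ℂ, CModel n) 𝓘(ℂ, CModel n) r x := by
    refine EventuallyEq.mfderiv_eq ?_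
    filter_upwards [φ.open_source.eventually_mem hx] with y hy
    exact congrArg r (φ.left_inv hy)
  rw [hderiv]
  refine Prod.ext ?_ rfl
  rw [mfderiv_comp x hsymm ((contMDiffAt_of_mem_maximalAtlas hφ hx).mdifferentiableAt
    (by simp)), mfderiv_eq_fderiv, ← hpx] at hcomp
  exact DFunLike.congr_fun hcomp v

end BaseFields

namespace HolLieAlgebroid

variable {n m : ℕ} {M : Type*} [TopologicalSpace M] [ChartedSpace (CModel n) M]
  [IsManifold 𝓘(ℂ, CModel n) ω M]
  {E : M → Type*} [TopologicalSpace (TotalSpace (CModel m) E)]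
  [∀ x, AddCommGroup (E x)] [∀ x, Module ℂ (E x)] [∀ x, TopologicalSpace (E x)]
  [FiberBundle (CModel m) E] {φ : OpenPartialHomeomorph M (CModel n)} {e : Fin m → ∀ x, E x}
  (L : HolLieAlgebroid n m M E)

theorem contMDiffAt_anchorDeriv_chart (hφ : φ ∈ IsManifold.maximalAtlas 𝓘(ℂ, CModel n) ω M)
    {x : M} (hx : x ∈ φ.source) {s : ∀ x, E x} (hs : IsHolAt n m s x) :
    ContMDiffAt 𝓘(ℂ, CModel n) 𝓘(ℂ, CModel n) ω (L.anchorDeriv s φ) x :=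
  L.contMDiffAt_anchorDeriv hs (contMDiffAt_of_mem_maximalAtlas hφ hx)

/-- The tangent vector `ρ^k_α a^α ∂/∂z^k` of `E` at `u` associated with `a^α e_α` in the
coordinates `(z^k, u^α)`. -/
def anchorLift (he : IsLocalFrameOn 𝓘(ℂ, CModel n) (CModel m) ω e φ.source)
    (u : TotalSpace (CModel m) E) : E u.proj →ₗ[ℂ] TangentSpace (totalModelC n m) u :=
  (coordVec he u).toLinearMap.comp ((LinearMap.inl ℂ (CModel n) (CModel m)).comp
    ((mfderiv 𝓘(ℂ, CModel n) 𝓘(ℂ, CModel n) φ u.proj).toLinearMap.comp (L.anchor u.proj)))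

variable (he : IsLocalFrameOn 𝓘(ℂ, CModel n) (CModel m) ω e φ.source)
  {u : TotalSpace (CModel m) E}

theorem sum_anchorCoeff_smul_hol_partialZ (α : Fin m) :
    ∑ k, L.anchorCoeff φ e α k u.proj • Cplx.hol (partialZ he k u)
      = Cplx.hol (L.anchorLift he u (e α u.proj)) := by
  have hsingle : ∀ k : Fin n, (fun l => if k = l then 1 else 0) = (Pi.single k 1 : CModel n) :=
    fun k => funext fun l => by rw [Pi.single_apply]; exact if_congr eq_comm rfl rfl
  have hsum := LinearMap.pi_apply_eq_sum_univ ((coordVec he u).toLinearMap.comp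
    (LinearMap.inl ℂ (CModel n) (CModel m))) (L.anchorDeriv (e α) φ u.proj)
  simp only [hsingle] at hsum
  refine Eq.trans ?_ (congrArg Cplx.holₗ hsum).symm
  rw [map_sum]
  exact Finset.sum_congr rfl fun k _ => (map_smul Cplx.holₗ _ _).symm

theorem anchorLift_eventuallyEq_coordField (hu : u.proj ∈ φ.source) (s : ∀ x, E x) :
    (fun w : TotalSpace (CModel m) E => L.anchorLift he w (s w.proj))
      =ᶠ[𝓝 u] coordField he (baseField m φ (L.anchorDeriv s φ)) := by
  filter_upwards [eventually_proj (φ.open_source.eventually_mem hu)] with w hw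
  exact congrArg (coordVec he w)
    (baseField_eq (r := L.anchorDeriv s φ) (p := bundleCoord he w) hw rfl).symm

end HolLieAlgebroid

section AnchorLift

variable {n m : ℕ} {M : Type*} [TopologicalSpace M] [ChartedSpace (CModel n) M]
  {E : M → Type*} [TopologicalSpace (TotalSpace (CModel m) E)]
  [∀ x, AddCommGroup (E x)] [∀ x, Module ℂ (E x)] [∀ x, TopologicalSpace (E x)]
  [FiberBundle (CModel m) E] {φ : OpenPartialHomeomorph M (CModel n)} {e : Fin m → ∀ x, E x}
  [VectorBundle ℂ (CModel m) E] [ContMDiffVectorBundle ω (CModel m) E 𝓘(ℂ, CModel n)]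
  (hφ : φ ∈ IsManifold.maximalAtlas 𝓘(ℂ, CModel n) ω M)
  (he : IsLocalFrameOn 𝓘(ℂ, CModel n) (CModel m) ω e φ.source)
  {u : TotalSpace (CModel m) E} (hu : u.proj ∈ φ.source)
include hφ hu

theorem mfderiv_chart_projDeriv (v : TangentSpace (totalModelC n m) u) :
    mfderiv 𝓘(ℂ, CModel n) 𝓘(ℂ, CModel n) φ u.proj (projDeriv n m E u v)
      = (mfderiv (totalModelC n m) 𝓘(ℂ, CModel n × CModel m) (bundleCoord he) u v :
          CModel n × CModel m).1 := by
  have hproj : MDifferentiableAt (totalModelC n m) 𝓘(ℂ, CModel n)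
      (fun w : TotalSpace (CModel m) E => w.proj) u :=
    (contMDiffAt_proj E (n := ω)).mdifferentiableAt (by simp)
  have hchart : MDifferentiableAt 𝓘(ℂ, CModel n) 𝓘(ℂ, CModel n) φ u.proj :=
    (contMDiffAt_of_mem_maximalAtlas hφ hu).mdifferentiableAt (by simp)
  have hcoord := (contMDiffAt_bundleCoord hφ he hu).mdifferentiableAt (by simp : ω ≠ 0)
  have hfst := (hasFDerivAt_fst (𝕜 := ℂ) (p := bundleCoord he u)).hasMFDerivAt.comp u
    hcoord.hasMFDerivAt
  exact (DFunLike.congr_fun (mfderiv_comp u hchart hproj) v).symm.trans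
    (DFunLike.congr_fun hfst.mfderiv v)

theorem ker_projDeriv : (projDeriv n m E u).ker = (verticalVec he u).range := by
  ext v
  constructor
  · intro hv
    have hfst := (mfderiv_chart_projDeriv hφ he hu v).symm.trans
      ((congrArg (mfderiv 𝓘(ℂ, CModel n) 𝓘(ℂ, CModel n) φ u.proj) hv).trans (map_zero _))
    refine ⟨(mfderiv (totalModelC n m) 𝓘(ℂ, CModel n × CModel m) (bundleCoord he) u v :
      CModel n × CModel m).2, Eq.trans ?_ (coordVec_mfderiv_bundleCoord hφ he hu v)⟩
    exact congrArg (coordVec he u) (Prod.ext hfst.symm rfl)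
  · rintro ⟨a, rfl⟩
    refine mfderiv_chart_injective hφ hu ((mfderiv_chart_projDeriv hφ he hu _).trans ?_)
    refine (congrArg Prod.fst (mfderiv_bundleCoord_coordVec hφ he hu (0, a))).trans ?_
    exact (map_zero _).symm

theorem projDeriv_verticalVec (a : CModel m) : projDeriv n m E u (verticalVec he u a) = 0 :=
  (ker_projDeriv hφ he hu).ge ⟨a, rfl⟩

variable [IsManifold 𝓘(ℂ, CModel n) ω M]

theorem mdifferentiableAt_verticalVec (a : CModel m) :
    MDifferentiableAt (totalModelC n m) (totalModelC n m).tangent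
      (fun w => (⟨w, verticalVec he w a⟩ :
        TangentBundle (totalModelC n m) (TotalSpace (CModel m) E))) u :=
  mdifferentiableAt_coordField hφ he hu (x := fun _ => (0, a)) contDiffAt_const

theorem mlieBracket_verticalVec (a b : CModel m) :
    VectorField.mlieBracket (totalModelC n m) (fun w => verticalVec he w a)
      (fun w => verticalVec he w b) u = 0 := by
  refine (mlieBracket_coordField hφ he hu (x := fun _ => (0, a)) (y := fun _ => (0, b))
    contDiffAt_const contDiffAt_const).trans ?_
  rw [fderiv_fun_const, fderiv_fun_const]
  exact (congrArg (coordVec he u) (sub_zero _)).trans (map_zero (coordVec he u))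

namespace HolLieAlgebroid

variable (L : HolLieAlgebroid n m M E)

theorem projDeriv_anchorLift (v : E u.proj) :
    projDeriv n m E u (L.anchorLift he u v) = L.anchor u.proj v :=
  mfderiv_chart_injective hφ hu ((mfderiv_chart_projDeriv hφ he hu _).trans
    (congrArg Prod.fst (mfderiv_bundleCoord_coordVec hφ he hu _)))

variable {s t r : ∀ x, E x}

theorem mdifferentiableAt_anchorLift (hs : IsHolAt n m s u.proj) :
    MDifferentiableAt (totalModelC n m) (totalModelC n m).tangent
      (fun w => (⟨w, L.anchorLift he w (s w.proj)⟩ :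
        TangentBundle (totalModelC n m) (TotalSpace (CModel m) E))) u := by
  have hdiff := mdifferentiableAt_coordField hφ he hu
    (contDiffAt_baseField hφ hu (L.contMDiffAt_anchorDeriv_chart hφ hu hs) rfl)
  refine hdiff.congr_of_eventuallyEq ?_
  filter_upwards [L.anchorLift_eventuallyEq_coordField he hu s] with w hw
  rw [hw]

theorem mlieBracket_anchorLift (hs : IsHolAt n m s u.proj) (ht : IsHolAt n m t u.proj)
    (hr : IsHolAt n m r u.proj) (hr0 : r u.proj ≠ 0) :
    VectorField.mlieBracket (totalModelC n m) (fun w => L.anchorLift he w (s w.proj))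
      (fun w => L.anchorLift he w (t w.proj)) u
      = L.anchorLift he u (L.bracket s t u.proj) := by
  have hs' := L.contMDiffAt_anchorDeriv_chart hφ hu hs
  have ht' := L.contMDiffAt_anchorDeriv_chart hφ hu ht
  refine ((L.anchorLift_eventuallyEq_coordField he hu s).mlieBracket_vectorField_eq
    (L.anchorLift_eventuallyEq_coordField he hu t)).trans ?_
  refine (mlieBracket_coordField hφ he hu (contDiffAt_baseField hφ hu hs' rfl)
    (contDiffAt_baseField hφ hu ht' rfl)).trans (congrArg (coordVec he u) ?_)
  rw [baseField_eq hu rfl, baseField_eq hu rfl]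
  refine (congrArg₂ (· - ·) (fderiv_baseField hφ hu ht' rfl (L.anchor u.proj (s u.proj)) 0)
    (fderiv_baseField hφ hu hs' rfl (L.anchor u.proj (t u.proj)) 0)).trans ?_
  refine Prod.ext ?_ (sub_zero _)
  exact (L.anchorDeriv_pi_bracket_of_ne_zero hs ht hr hr0
    (contMDiffAt_of_mem_maximalAtlas hφ hu)).symm

theorem mlieBracket_anchorLift_verticalVec (hs : IsHolAt n m s u.proj) (a : CModel m) :
    VectorField.mlieBracket (totalModelC n m) (fun w => L.anchorLift he w (s w.proj))
      (fun w => verticalVec he w a) u = 0 := by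
  have hs' := L.contMDiffAt_anchorDeriv_chart hφ hu hs
  refine ((L.anchorLift_eventuallyEq_coordField he hu s).mlieBracket_vectorField_eq
    EventuallyEq.rfl).trans ?_
  refine (mlieBracket_coordField hφ he hu (y := fun _ => (0, a))
    (contDiffAt_baseField hφ hu hs' rfl) contDiffAt_const).trans ?_
  have hvert := fderiv_baseField hφ hu hs' (p := bundleCoord he u) rfl 0 a
  rw [map_zero, map_zero] at hvert
  rw [fderiv_fun_const]
  refine (congrArg (coordVec he u) ?_).trans (map_zero (coordVec he u))
  exact (congrArg₂ (· - ·) rfl hvert).trans (sub_zero _)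

end HolLieAlgebroid

end AnchorLift

section RealDeriv

variable {n m : ℕ} {M : Type*} [TopologicalSpace M] [ChartedSpace (CModel n) M]
  {E : M → Type*} [TopologicalSpace (TotalSpace (CModel m) E)]
  [∀ x, TopologicalSpace (E x)] [FiberBundle (CModel m) E]
  {g g' : TotalSpace (CModel m) E → CModel m} {u : TotalSpace (CModel m) E}

theorem realDeriv_congr (h : g =ᶠ[𝓝 u] g') (v : TangentSpace (totalModelC n m) u) :
    realDeriv g u v = realDeriv g' u v :=
  DFunLike.congr_fun (h.mfderiv_eq (I := totalModelR n m) (I' := 𝓘(ℝ, CModel m))) v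

variable (hg : MDifferentiableAt (totalModelC n m) 𝓘(ℂ, CModel m) g u) (c : ℂ)
  (v : TangentSpace (totalModelC n m) u)
include hg

theorem realDeriv_eq_mfderiv :
    realDeriv g u v = mfderiv (totalModelC n m) 𝓘(ℂ, CModel m) g u v :=
  DFunLike.congr_fun (hasMFDerivAt_restrictScalars (I := totalModelC n m)
    (I' := 𝓘(ℂ, CModel m)) (J := totalModelR n m) (J' := 𝓘(ℝ, CModel m)) rfl rfl
    hg.hasMFDerivAt).mfderiv v

theorem realDeriv_smul : realDeriv g u (c • v) = c • realDeriv g u v := by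
  rw [realDeriv_eq_mfderiv hg, realDeriv_eq_mfderiv hg]
  exact (mfderiv (totalModelC n m) 𝓘(ℂ, CModel m) g u).map_smul c v

theorem realDeriv_const_smul : realDeriv (c • g) u v = c • realDeriv g u v := by
  have h := hg.hasMFDerivAt.const_smul c
  rw [realDeriv_eq_mfderiv hg, realDeriv_eq_mfderiv h.mdifferentiableAt, h.mfderiv]
  rfl

end RealDeriv

section HolPair

variable {n m : ℕ} {M : Type*} [TopologicalSpace M] [ChartedSpace (CModel n) M]
  {E : M → Type*} [TopologicalSpace (TotalSpace (CModel m) E)]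
  [∀ x, AddCommGroup (E x)] [∀ x, Module ℂ (E x)] [∀ x, TopologicalSpace (E x)]
  [FiberBundle (CModel m) E] {u : TotalSpace (CModel m) E}

section FibreCoord

variable [VectorBundle ℂ (CModel m) E] (c : ℂ) (s : ∀ w : TotalSpace (CModel m) E, E w.proj)

theorem fibreCoord_const_smul {b : M}
    (hu : u.proj ∈ (trivializationAt (CModel m) E b).baseSet) :
    fibreCoord b (fun w => c • s w) u = c • fibreCoord b s u := by
  rw [fibreCoord, fibreCoord, trivializationAt_snd_eq hu, trivializationAt_snd_eq hu, map_smul]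

theorem fibreCoord_const_smul_eventuallyEq (u : TotalSpace (CModel m) E) :
    fibreCoord u.proj (fun w => c • s w) =ᶠ[𝓝 u] c • fibreCoord u.proj s := by
  filter_upwards [eventually_proj (eventually_mem_baseSet_trivializationAt m E u.proj)] with w hw
  exact fibreCoord_const_smul c s hw

end FibreCoord

variable [IsManifold 𝓘(ℂ, CModel n) ω M] [VectorBundle ℂ (CModel m) E]
  [ContMDiffVectorBundle ω (CModel m) E 𝓘(ℂ, CModel n)]

/-- The section `Z = (s, X)` of `π^*E × TE` is complex differentiable at `u`. -/
structure IsHolPairAt (Z : ∀ w : TotalSpace (CModel m) E, HolFibre n m E w)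
    (u : TotalSpace (CModel m) E) : Prop where
  fibre : MDifferentiableAt (totalModelC n m) 𝓘(ℂ, CModel m)
    (fibreCoord u.proj fun w => (Z w).1) u
  field : MDifferentiableAt (totalModelC n m) (totalModelC n m).tangent
    (fun w => (⟨w, (Z w).2⟩ : TangentBundle (totalModelC n m) (TotalSpace (CModel m) E))) u

/-- The section `S` of `E_ℂ × T_ℂ E` is of type `(1,0)`, and complex differentiable at `u`. -/
def IsHolSectionAt (S : ∀ w : TotalSpace (CModel m) E, AmbientFibre n m E w)
    (u : TotalSpace (CModel m) E) : Prop :=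
  ∃ Z, IsHolPairAt Z u ∧ S = fun w => holFibreₗ (Z w)

namespace HolLieAlgebroid

variable (L : HolLieAlgebroid n m M E)

/-- The bracket of two sections of the real prolongation, given as sections of `π^*E × TE`. -/
abbrev pairBracket (Z W : ∀ w : TotalSpace (CModel m) E, HolFibre n m E w)
    (u : TotalSpace (CModel m) E) : HolFibre n m E u :=
  L.realBracket (fun w => (Z w).1) (fun w => (W w).1) (fun w => (Z w).2) (fun w => (W w).2) u

theorem pairBracket_smul_smul {Z W : ∀ w : TotalSpace (CModel m) E, HolFibre n m E w}
    (hZ : IsHolPairAt Z u) (hW : IsHolPairAt W u) (c d : ℂ) :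
    L.pairBracket (fun w => c • Z w) (fun w => d • W w) u = (c * d) • L.pairBracket Z W u := by
  have hb := mem_baseSet_trivializationAt (CModel m) E u.proj
  refine Prod.ext ?_ ?_
  · simp only [pairBracket, realBracket, Prod.smul_fst, Prod.smul_snd]
    rw [← Trivialization.coe_symmₗ (R := ℂ) _ hb, ← map_smul,
      realDeriv_congr (fibreCoord_const_smul_eventuallyEq d _ u),
      realDeriv_congr (fibreCoord_const_smul_eventuallyEq c _ u),
      realDeriv_const_smul hW.fibre, realDeriv_const_smul hZ.fibre, realDeriv_smul hW.fibre,
      realDeriv_smul hZ.fibre, fibreCoord_const_smul _ _ hb, fibreCoord_const_smul _ _ hb,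
      L.constBracket_smul_smul]
    congr 1
    module
  · have hX := MDifferentiableAt.smul_section (mdifferentiableAt_const (c := c)) hZ.field
    have hY := MDifferentiableAt.smul_section (mdifferentiableAt_const (c := d)) hW.field
    refine (mlieBracket_restrictScalars (I := totalModelC n m) (J := totalModelR n m) rfl hX
      hY).trans ?_
    refine Eq.trans ?_ (congrArg ((c * d) • · : TangentSpace (totalModelC n m) u → _)
      (mlieBracket_restrictScalars (I := totalModelC n m) (J := totalModelR n m) rfl hZ.field
        hW.field)).symm
    refine (VectorField.mlieBracket_const_smul_left hZ.field).trans ?_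
    refine (congrArg _ (VectorField.mlieBracket_const_smul_right hW.field)).trans ?_
    exact smul_smul c d _

end HolLieAlgebroid

end HolPair

section ComplexBracket

variable {n m : ℕ} {M : Type*} [TopologicalSpace M] [ChartedSpace (CModel n) M]
  {E : M → Type*} [TopologicalSpace (TotalSpace (CModel m) E)]
  [∀ x, AddCommGroup (E x)] [∀ x, Module ℂ (E x)] [∀ x, TopologicalSpace (E x)]
  [FiberBundle (CModel m) E] {u : TotalSpace (CModel m) E}

/-- The element `a p + i b p` of `E_ℂ × T_ℂ E`, where `a p` and `b p` are formed in `E × TE`. -/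
def scaledFibre (a b : ℂ) (p : HolFibre n m E u) : AmbientFibre n m E u :=
  (Cplx.ofScalars a b p.1, Cplx.ofScalars a b p.2)

theorem holFibre_eq_scaledFibre (p : HolFibre n m E u) :
    holFibreₗ p = scaledFibre (1 / 2) (-(Complex.I / 2)) p :=
  Prod.ext (Cplx.hol_eq_ofScalars p.1) (Cplx.hol_eq_ofScalars p.2)

theorem conjFibre_holFibre_eq_scaledFibre (p : HolFibre n m E u) :
    conjFibre (holFibreₗ p) = scaledFibre (1 / 2) (Complex.I / 2) p :=
  Prod.ext (Cplx.conj_hol_eq_ofScalars p.1) (Cplx.conj_hol_eq_ofScalars p.2)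

theorem scaledFibre_zero_zero (p : HolFibre n m E u) : scaledFibre 0 0 p = 0 := by
  simp only [scaledFibre, Cplx.ofScalars, zero_smul]
  rfl

namespace HolLieAlgebroid

variable [IsManifold 𝓘(ℂ, CModel n) ω M] [VectorBundle ℂ (CModel m) E]
  [ContMDiffVectorBundle ω (CModel m) E 𝓘(ℂ, CModel n)] (L : HolLieAlgebroid n m M E)

theorem realBracket_swap (s t : ∀ w : TotalSpace (CModel m) E, E w.proj)
    (X Y : ∀ w : TotalSpace (CModel m) E, TangentSpace (totalModelC n m) w) :
    L.realBracket t s Y X u = -L.realBracket s t X Y u := by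
  have hb := mem_baseSet_trivializationAt (CModel m) E u.proj
  refine Prod.ext ?_ VectorField.mlieBracket_swap_apply
  simp only [realBracket, Prod.fst_neg]
  rw [← Trivialization.coe_symmₗ (R := ℂ) _ hb, ← map_neg, L.constBracket_skew]
  congr 1
  abel

theorem prolongBracket_swap (S T : ∀ w : TotalSpace (CModel m) E, AmbientFibre n m E w) :
    L.prolongBracket T S u = -L.prolongBracket S T u := by
  simp only [prolongBracket]
  rw [L.realBracket_swap (fun w => (S w).1.re) (fun w => (T w).1.re),
    L.realBracket_swap (fun w => (S w).1.im) (fun w => (T w).1.im),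
    L.realBracket_swap (fun w => (S w).1.im) (fun w => (T w).1.re),
    L.realBracket_swap (fun w => (S w).1.re) (fun w => (T w).1.im)]
  refine Prod.ext (Cplx.ext ?_ ?_) (Cplx.ext ?_ ?_)
  · exact (neg_sub_neg _ _).trans (neg_sub _ _).symm
  · exact (neg_add_rev _ _).symm
  · exact (neg_sub_neg _ _).trans (neg_sub _ _).symm
  · exact (neg_add_rev _ _).symm

variable {L} in
theorem prolongBracket_eq_zero_symm
    {S T : ∀ w : TotalSpace (CModel m) E, AmbientFibre n m E w}
    (h : L.prolongBracket S T u = 0) : L.prolongBracket T S u = 0 := by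
  rw [L.prolongBracket_swap, h, neg_zero]

section Pairs

variable {Z W : ∀ w : TotalSpace (CModel m) E, HolFibre n m E w}
  (hZ : IsHolPairAt Z u) (hW : IsHolPairAt W u)
include hZ hW

theorem prolongBracket_scaledFibre (a b c d : ℂ) :
    L.prolongBracket (fun w => scaledFibre a b (Z w)) (fun w => scaledFibre c d (W w)) u
      = scaledFibre (a * c - b * d) (a * d + b * c) (L.pairBracket Z W u) := by
  have h := fun c d => L.pairBracket_smul_smul hZ hW c d
  simp only [pairBracket, Prod.smul_fst, Prod.smul_snd] at h
  simp only [prolongBracket, scaledFibre, Cplx.ofScalars, h, sub_smul, add_smul,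
    Prod.smul_fst, Prod.smul_snd]

theorem prolongBracket_holFibre :
    L.prolongBracket (fun w => holFibreₗ (Z w)) (fun w => holFibreₗ (W w)) u
      = holFibreₗ (L.pairBracket Z W u) := by
  have hre : (1 / 2 * (1 / 2) - -(Complex.I / 2) * -(Complex.I / 2) : ℂ) = 1 / 2 := by
    linear_combination (-(1 / 4) : ℂ) * Complex.I_mul_I
  have him : (1 / 2 * -(Complex.I / 2) + -(Complex.I / 2) * (1 / 2) : ℂ) = -(Complex.I / 2) := by
    ring
  simp only [holFibre_eq_scaledFibre, L.prolongBracket_scaledFibre hZ hW, hre, him]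

end Pairs

variable {S T : ∀ w : TotalSpace (CModel m) E, AmbientFibre n m E w}

theorem prolongBracket_conj_conj (hS : IsHolSectionAt S u) (hT : IsHolSectionAt T u) :
    L.prolongBracket (fun w => conjFibre (S w)) (fun w => conjFibre (T w)) u
      = conjFibre (L.prolongBracket S T u) := by
  obtain ⟨Z, hZ, rfl⟩ := hS
  obtain ⟨W, hW, rfl⟩ := hT
  have hre : (1 / 2 * (1 / 2) - Complex.I / 2 * (Complex.I / 2) : ℂ) = 1 / 2 := by
    linear_combination (-(1 / 4) : ℂ) * Complex.I_mul_I
  have him : (1 / 2 * (Complex.I / 2) + Complex.I / 2 * (1 / 2) : ℂ) = Complex.I / 2 := by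
    ring
  rw [L.prolongBracket_holFibre hZ hW]
  simp only [conjFibre_holFibre_eq_scaledFibre, L.prolongBracket_scaledFibre hZ hW, hre, him]

theorem prolongBracket_conj_conj_eq_zero (hS : IsHolSectionAt S u) (hT : IsHolSectionAt T u)
    (h : L.prolongBracket S T u = 0) :
    L.prolongBracket (fun w => conjFibre (S w)) (fun w => conjFibre (T w)) u = 0 := by
  rw [L.prolongBracket_conj_conj hS hT, h]
  exact map_zero conjFibreₗ

theorem prolongBracket_conj_right (hS : IsHolSectionAt S u) (hT : IsHolSectionAt T u) :
    L.prolongBracket S (fun w => conjFibre (T w)) u = 0 := by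
  obtain ⟨Z, hZ, rfl⟩ := hS
  obtain ⟨W, hW, rfl⟩ := hT
  have hre : (1 / 2 * (1 / 2) - -(Complex.I / 2) * (Complex.I / 2) : ℂ) = 0 := by
    linear_combination (1 / 4 : ℂ) * Complex.I_mul_I
  have him : (1 / 2 * (Complex.I / 2) + -(Complex.I / 2) * (1 / 2) : ℂ) = 0 := by
    ring
  simp only [conjFibre_holFibre_eq_scaledFibre]
  simp only [holFibre_eq_scaledFibre, L.prolongBracket_scaledFibre hZ hW, hre, him,
    scaledFibre_zero_zero]

theorem prolongBracket_conj_left (hS : IsHolSectionAt S u) (hT : IsHolSectionAt T u) :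
    L.prolongBracket (fun w => conjFibre (S w)) T u = 0 :=
  prolongBracket_eq_zero_symm (L.prolongBracket_conj_right hT hS)

end HolLieAlgebroid

end ComplexBracket

section PulledBackSections

variable {n m : ℕ} {M : Type*} [TopologicalSpace M] [ChartedSpace (CModel n) M]
  {E : M → Type*} [TopologicalSpace (TotalSpace (CModel m) E)]
  [∀ x, AddCommGroup (E x)] [∀ x, Module ℂ (E x)] [∀ x, TopologicalSpace (E x)]
  [FiberBundle (CModel m) E] [VectorBundle ℂ (CModel m) E]
  [ContMDiffVectorBundle ω (CModel m) E 𝓘(ℂ, CModel n)] {u : TotalSpace (CModel m) E}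
  {s t : ∀ x, E x}

theorem mdifferentiableAt_fibreCoord (hs : IsHolAt n m s u.proj) :
    MDifferentiableAt (totalModelC n m) 𝓘(ℂ, CModel m)
      (fibreCoord u.proj fun w => s w.proj) u :=
  ((hs.trivialization_snd (mem_baseSet_trivializationAt (CModel m) E u.proj)).comp u
    (contMDiffAt_proj E)).mdifferentiableAt (by simp)

theorem realDeriv_fibreCoord (hs : IsHolAt n m s u.proj)
    (v : TangentSpace (totalModelC n m) u) :
    realDeriv (fibreCoord u.proj fun w => s w.proj) u v
      = mfderiv 𝓘(ℂ, CModel n) 𝓘(ℂ, CModel m) (sectionCoord m u.proj s) u.proj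
          (projDeriv n m E u v) := by
  have hcoord := hs.trivialization_snd (mem_baseSet_trivializationAt (CModel m) E u.proj)
  have hcomp := mfderiv_comp u (hcoord.mdifferentiableAt (by simp))
    ((contMDiffAt_proj E (IB := 𝓘(ℂ, CModel n)) (n := ω) (p := u)).mdifferentiableAt (by simp))
  rw [realDeriv_eq_mfderiv (mdifferentiableAt_fibreCoord hs)]
  exact DFunLike.congr_fun hcomp v

theorem HolLieAlgebroid.realBracket_comp_proj [IsManifold 𝓘(ℂ, CModel n) ω M]
    (L : HolLieAlgebroid n m M E) (hs : IsHolAt n m s u.proj) (ht : IsHolAt n m t u.proj)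
    {X Y : ∀ w : TotalSpace (CModel m) E, TangentSpace (totalModelC n m) w}
    (hX : MDifferentiableAt (totalModelC n m) (totalModelC n m).tangent
      (fun w => (⟨w, X w⟩ : TangentBundle (totalModelC n m) (TotalSpace (CModel m) E))) u)
    (hY : MDifferentiableAt (totalModelC n m) (totalModelC n m).tangent
      (fun w => (⟨w, Y w⟩ : TangentBundle (totalModelC n m) (TotalSpace (CModel m) E))) u)
    (hsX : projDeriv n m E u (X u) = L.anchor u.proj (s u.proj))
    (htY : projDeriv n m E u (Y u) = L.anchor u.proj (t u.proj)) :
    L.realBracket (fun w => s w.proj) (fun w => t w.proj) X Y u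
      = (L.bracket s t u.proj, VectorField.mlieBracket (totalModelC n m) X Y u) := by
  refine Prod.ext ?_
    (mlieBracket_restrictScalars (I := totalModelC n m) (J := totalModelR n m) rfl hX hY)
  rw [realBracket, realDeriv_fibreCoord hs, realDeriv_fibreCoord ht, hsX, htY,
    L.bracket_eq_constBracket hs ht]
  rfl

end PulledBackSections

section NaturalFrame

variable {n m : ℕ} {M : Type*} [TopologicalSpace M] [ChartedSpace (CModel n) M]
  {E : M → Type*} [TopologicalSpace (TotalSpace (CModel m) E)]
  [∀ x, AddCommGroup (E x)] [∀ x, Module ℂ (E x)] [∀ x, TopologicalSpace (E x)]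
  [FiberBundle (CModel m) E] {φ : OpenPartialHomeomorph M (CModel n)} {e : Fin m → ∀ x, E x}

/-- The pair `(0, a^α ∂/∂u^α)` at `u`. For `a` in the standard basis its `(1,0)`-part is
`𝒱_α`. -/
def verticalFibre (he : IsLocalFrameOn 𝓘(ℂ, CModel n) (CModel m) ω e φ.source)
    (u : TotalSpace (CModel m) E) : CModel m →ₗ[ℂ] HolFibre n m E u :=
  (LinearMap.inr ℂ _ _).comp (verticalVec he u)

theorem secV_eq_holFibre (he : IsLocalFrameOn 𝓘(ℂ, CModel n) (CModel m) ω e φ.source)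
    (α : Fin m) :
    secV he α = fun w => holFibreₗ (verticalFibre he w (Pi.basisFun ℂ (Fin m) α)) := by
  rw [Pi.basisFun_apply]
  exact funext fun _ => Prod.ext (map_zero Cplx.holₗ).symm rfl

namespace HolLieAlgebroid

variable [IsManifold 𝓘(ℂ, CModel n) ω M] (L : HolLieAlgebroid n m M E)

/-- The pair `(a^α e_α, ρ^k_α a^α ∂/∂z^k)` at `u` associated with `a^α e_α`. The `(1,0)`-part of
the pair associated with `e_α` is `𝒵_α`. -/
def liftFibre (he : IsLocalFrameOn 𝓘(ℂ, CModel n) (CModel m) ω e φ.source)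
    (u : TotalSpace (CModel m) E) : E u.proj →ₗ[ℂ] HolFibre n m E u :=
  LinearMap.id.prod (L.anchorLift he u)

/-- The frame `{(e_α, ρ^k_α ∂/∂z^k), (0, ∂/∂u^α)}` of the real prolongation, as a family of
vectors of `E × TE`. Its `(1,0)`-part is `{𝒵_α, 𝒱_α}`. -/
def holFrame (he : IsLocalFrameOn 𝓘(ℂ, CModel n) (CModel m) ω e φ.source)
    (u : TotalSpace (CModel m) E) : Fin m ⊕ Fin m → HolFibre n m E u :=
  Sum.elim (L.liftFibre he u ∘ fun α => e α u.proj)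
    (verticalFibre he u ∘ Pi.basisFun ℂ (Fin m))

variable (hφ : φ ∈ IsManifold.maximalAtlas 𝓘(ℂ, CModel n) ω M)
  (he : IsLocalFrameOn 𝓘(ℂ, CModel n) (CModel m) ω e φ.source)
  {u : TotalSpace (CModel m) E} (hu : u.proj ∈ φ.source)

theorem secZ_eq_holFibre (α : Fin m) :
    L.secZ he α = fun w => holFibreₗ (L.liftFibre he w (e α w.proj)) :=
  funext fun _ => Prod.ext rfl (L.sum_anchorCoeff_smul_hol_partialZ he α)

theorem naturalFrame_eq_sumElim :
    L.naturalFrame he u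
      = Sum.elim (holFibreₗ ∘ L.holFrame he u) (conjFibreₗ.comp holFibreₗ ∘ L.holFrame he u) := by
  have hZ := fun α => congrFun (L.secZ_eq_holFibre he α) u
  have hV := fun α => congrFun (secV_eq_holFibre he α) u
  funext i
  rcases i with (α | α) | (α | α)
  exacts [hZ α, hV α, congrArg conjFibre (hZ α), congrArg conjFibre (hV α)]

variable [VectorBundle ℂ (CModel m) E] [ContMDiffVectorBundle ω (CModel m) E 𝓘(ℂ, CModel n)]
include hφ hu

theorem eq_zero_of_liftFibre_add_verticalFibre {v : E u.proj} {a : CModel m}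
    (h : L.liftFibre he u v + verticalFibre he u a = 0) : v = 0 ∧ a = 0 := by
  have hv : v = 0 := (add_zero v).symm.trans (congrArg Prod.fst h)
  subst hv
  rw [map_zero, zero_add] at h
  have hcoord := (mfderiv_bundleCoord_coordVec hφ he hu (0, a)).symm.trans
    ((congrArg (mfderiv (totalModelC n m) 𝓘(ℂ, CModel n × CModel m) (bundleCoord he) u)
      (congrArg Prod.snd h)).trans (ContinuousLinearMap.map_zero _))
  exact ⟨rfl, congrArg Prod.snd hcoord⟩

theorem linearIndependent_holFrame : LinearIndependent ℂ (L.holFrame he u) :=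
  linearIndependent_sumElim_comp
    (fun _ _ => L.eq_zero_of_liftFibre_add_verticalFibre hφ he hu) (he.linearIndependent hu)
    (Pi.basisFun ℂ (Fin m)).linearIndependent

theorem range_liftFibre_sup_range_verticalFibre :
    (L.liftFibre he u).range ⊔ (verticalFibre he u).range = (L.anchorDefect u).ker := by
  refine le_antisymm (sup_le ?_ ?_) fun p hp => ?_
  · rintro _ ⟨v, rfl⟩
    exact sub_eq_zero.2 (L.projDeriv_anchorLift hφ he hu v).symm
  · rintro _ ⟨a, rfl⟩
    exact sub_eq_zero.2 ((map_zero (L.anchor u.proj)).trans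
      (projDeriv_verticalVec hφ he hu a).symm)
  · have hvert : p.2 - L.anchorLift he u p.1 ∈ (projDeriv n m E u).ker := by
      refine (map_sub _ _ _).trans (sub_eq_zero.2 ?_)
      exact (sub_eq_zero.1 hp).symm.trans (L.projDeriv_anchorLift hφ he hu p.1).symm
    obtain ⟨a, ha⟩ := (ker_projDeriv hφ he hu).le hvert
    have hp_eq : L.liftFibre he u p.1 + verticalFibre he u a = p :=
      Prod.ext (add_zero _) ((congrArg _ ha).trans (add_sub_cancel _ _))
    exact hp_eq ▸ Submodule.add_mem_sup ⟨_, rfl⟩ ⟨_, rfl⟩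

theorem span_holFrame :
    Submodule.span ℂ (range (L.holFrame he u)) = (L.anchorDefect u).ker := by
  have hframe : Submodule.span ℂ (range fun α => e α u.proj) = ⊤ := top_le_iff.1 (he.generating hu)
  rw [holFrame, span_range_sumElim_comp, hframe, (Pi.basisFun ℂ (Fin m)).span_eq,
    Submodule.map_top, Submodule.map_top, L.range_liftFibre_sup_range_verticalFibre hφ he hu]

theorem linearIndependent_naturalFrame : LinearIndependent ℂ (L.naturalFrame he u) := by
  have hindep := L.linearIndependent_holFrame hφ he hu
  rw [naturalFrame_eq_sumElim]
  exact linearIndependent_sumElim_comp (fun _ _ => eq_zero_of_holFibre_add_conj) hindep hindep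

theorem span_naturalFrame :
    Submodule.span ℂ (range (L.naturalFrame he u)) = L.prolongation u := by
  rw [naturalFrame_eq_sumElim, span_range_sumElim_comp, L.span_holFrame hφ he hu,
    prolongation_eq_sup]

end HolLieAlgebroid

end NaturalFrame

section FrameBrackets

variable {n m : ℕ} {M : Type*} [TopologicalSpace M] [ChartedSpace (CModel n) M]
  {E : M → Type*} [TopologicalSpace (TotalSpace (CModel m) E)]
  [∀ x, AddCommGroup (E x)] [∀ x, Module ℂ (E x)] [∀ x, TopologicalSpace (E x)]
  [FiberBundle (CModel m) E] {φ : OpenPartialHomeomorph M (CModel n)} {e : Fin m → ∀ x, E x}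
  [IsManifold 𝓘(ℂ, CModel n) ω M] [VectorBundle ℂ (CModel m) E]
  [ContMDiffVectorBundle ω (CModel m) E 𝓘(ℂ, CModel n)]
  (hφ : φ ∈ IsManifold.maximalAtlas 𝓘(ℂ, CModel n) ω M)
  (he : IsLocalFrameOn 𝓘(ℂ, CModel n) (CModel m) ω e φ.source)
  {u : TotalSpace (CModel m) E} (hu : u.proj ∈ φ.source)
include hφ hu

theorem isHolPairAt_verticalFibre (a : CModel m) :
    IsHolPairAt (fun w => verticalFibre he w a) u :=
  ⟨mdifferentiableAt_fibreCoord (s := 0) (isHolAt_zero E _),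
    mdifferentiableAt_verticalVec hφ he hu a⟩

theorem isHolSectionAt_secV (α : Fin m) : IsHolSectionAt (secV he α) u :=
  ⟨_, isHolPairAt_verticalFibre hφ he hu _, secV_eq_holFibre he α⟩

namespace HolLieAlgebroid

variable (L : HolLieAlgebroid n m M E)

theorem isHolPairAt_liftFibre {s : ∀ x, E x} (hs : IsHolAt n m s u.proj) :
    IsHolPairAt (fun w => L.liftFibre he w (s w.proj)) u :=
  ⟨mdifferentiableAt_fibreCoord hs, L.mdifferentiableAt_anchorLift hφ he hu hs⟩

theorem isHolSectionAt_secZ (α : Fin m) : IsHolSectionAt (L.secZ he α) u :=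
  ⟨_, L.isHolPairAt_liftFibre hφ he hu (he.contMDiffAt φ.open_source hu α),
    L.secZ_eq_holFibre he α⟩

theorem projDeriv_verticalVec_eq_anchor_zero (a : CModel m) :
    projDeriv n m E u (verticalVec he u a) = L.anchor u.proj ((0 : ∀ x, E x) u.proj) :=
  (projDeriv_verticalVec hφ he hu a).trans (map_zero _).symm

section

variable {s t r : ∀ x, E x} (hs : IsHolAt n m s u.proj)
include hs

theorem pairBracket_liftFibre_liftFibre (ht : IsHolAt n m t u.proj)
    (hr : IsHolAt n m r u.proj) (hr0 : r u.proj ≠ 0) :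
    L.pairBracket (fun w => L.liftFibre he w (s w.proj)) (fun w => L.liftFibre he w (t w.proj)) u
      = L.liftFibre he u (L.bracket s t u.proj) :=
  (L.realBracket_comp_proj hs ht (L.mdifferentiableAt_anchorLift hφ he hu hs)
    (L.mdifferentiableAt_anchorLift hφ he hu ht) (L.projDeriv_anchorLift hφ he hu _)
    (L.projDeriv_anchorLift hφ he hu _)).trans
    (Prod.ext rfl (L.mlieBracket_anchorLift hφ he hu hs ht hr hr0))

theorem pairBracket_liftFibre_verticalFibre (a : CModel m) :
    L.pairBracket (fun w => L.liftFibre he w (s w.proj)) (fun w => verticalFibre he w a) u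
      = 0 :=
  (L.realBracket_comp_proj hs (isHolAt_zero E _) (L.mdifferentiableAt_anchorLift hφ he hu hs)
    (mdifferentiableAt_verticalVec hφ he hu a) (L.projDeriv_anchorLift hφ he hu _)
    (L.projDeriv_verticalVec_eq_anchor_zero hφ he hu a)).trans
    (Prod.ext (L.bracket_zero_right hs) (L.mlieBracket_anchorLift_verticalVec hφ he hu hs a))

end

theorem pairBracket_verticalFibre_verticalFibre (a b : CModel m) :
    L.pairBracket (fun w => verticalFibre he w a) (fun w => verticalFibre he w b) u = 0 :=
  (L.realBracket_comp_proj (isHolAt_zero E _) (isHolAt_zero E _)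
    (mdifferentiableAt_verticalVec hφ he hu a) (mdifferentiableAt_verticalVec hφ he hu b)
    (L.projDeriv_verticalVec_eq_anchor_zero hφ he hu a)
    (L.projDeriv_verticalVec_eq_anchor_zero hφ he hu b)).trans
    (Prod.ext (L.bracket_zero_right (isHolAt_zero E _)) (mlieBracket_verticalVec hφ he hu a b))

theorem prolongBracket_secZ_secZ (α β : Fin m) :
    L.prolongBracket (L.secZ he α) (L.secZ he β) u
      = ∑ γ, L.structureFn he α β γ u.proj • L.secZ he γ u := by
  have he' := he.contMDiffAt φ.open_source hu
  have hne : e α u.proj ≠ 0 := (he.linearIndependent hu).ne_zero α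
  have hbracket := L.pairBracket_liftFibre_liftFibre hφ he hu (he' α) (he' β) (he' α) hne
  simp only [secZ_eq_holFibre]
  rw [L.prolongBracket_holFibre (L.isHolPairAt_liftFibre hφ he hu (he' α))
    (L.isHolPairAt_liftFibre hφ he hu (he' β)), hbracket,
    ← sum_coeff_smul_frame he hu (L.bracket (e α) (e β) u.proj)]
  simp only [map_sum, map_smul, structureFn]

theorem prolongBracket_secZ_secV (α β : Fin m) :
    L.prolongBracket (L.secZ he α) (secV he β) u = 0 := by
  have hα := he.contMDiffAt φ.open_source hu α
  rw [secZ_eq_holFibre, secV_eq_holFibre,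
    L.prolongBracket_holFibre (L.isHolPairAt_liftFibre hφ he hu hα)
      (isHolPairAt_verticalFibre hφ he hu _),
    L.pairBracket_liftFibre_verticalFibre hφ he hu hα, map_zero]

theorem prolongBracket_secV_secV (α β : Fin m) :
    L.prolongBracket (secV he α) (secV he β) u = 0 := by
  rw [secV_eq_holFibre, secV_eq_holFibre,
    L.prolongBracket_holFibre (isHolPairAt_verticalFibre hφ he hu _)
      (isHolPairAt_verticalFibre hφ he hu _),
    L.pairBracket_verticalFibre_verticalFibre hφ he hu, map_zero]

theorem prolongBracket_secZbar_secZbar (α β : Fin m) :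
    L.prolongBracket (L.secZbar he α) (L.secZbar he β) u
      = ∑ γ, (starRingEnd ℂ) (L.structureFn he α β γ u.proj) • L.secZbar he γ u := by
  refine (L.prolongBracket_conj_conj (L.isHolSectionAt_secZ hφ he hu α)
    (L.isHolSectionAt_secZ hφ he hu β)).trans ?_
  rw [L.prolongBracket_secZ_secZ hφ he hu]
  refine (map_sum conjFibreₗ _ _).trans (Finset.sum_congr rfl fun γ _ => ?_)
  exact conjFibreₗ.map_smulₛₗ _ _

end HolLieAlgebroid

end FrameBrackets

end

theorem proposition1p1 {n m : ℕ}
    {M : Type*} [TopologicalSpace M] [ChartedSpace (CModel n) M]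
    [IsManifold 𝓘(ℂ, CModel n) ω M]
    {E : M → Type*} [TopologicalSpace (TotalSpace (CModel m) E)]
    [∀ x, AddCommGroup (E x)] [∀ x, Module ℂ (E x)] [∀ x, TopologicalSpace (E x)]
    [FiberBundle (CModel m) E] [VectorBundle ℂ (CModel m) E]
    [ContMDiffVectorBundle ω (CModel m) E 𝓘(ℂ, CModel n)]
    (L : HolLieAlgebroid n m M E)
    (φ : OpenPartialHomeomorph M (CModel n))
    (hφ : φ ∈ IsManifold.maximalAtlas 𝓘(ℂ, CModel n) ω M)
    (e : Fin m → ∀ x, E x)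
    (he : IsLocalFrameOn 𝓘(ℂ, CModel n) (CModel m) ω e φ.source)
    (u : TotalSpace (CModel m) E) (hu : u.proj ∈ φ.source) :
    -- the sections form a basis of the fibre of the complexified prolongation at `u`
    (LinearIndependent ℂ (L.naturalFrame he u) ∧
      Submodule.span ℂ (Set.range (L.naturalFrame he u)) = L.prolongation u) ∧
    ∀ α β : Fin m,
      L.prolongBracket (L.secZ he α) (L.secZ he β) u
        = ∑ γ, L.structureFn he α β γ u.proj • L.secZ he γ u ∧
      L.prolongBracket (L.secZ he α) (secV he β) u = 0 ∧
      L.prolongBracket (secV he α) (secV he β) u = 0 ∧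
      L.prolongBracket (L.secZ he α) (L.secZbar he β) u = 0 ∧
      L.prolongBracket (L.secZ he α) (secVbar he β) u = 0 ∧
      L.prolongBracket (secV he α) (secVbar he β) u = 0 ∧
      -- the conjugate relations
      L.prolongBracket (L.secZbar he α) (L.secZbar he β) u
        = conjFibre (L.prolongBracket (L.secZ he α) (L.secZ he β) u) ∧
      L.prolongBracket (L.secZbar he α) (L.secZbar he β) u
        = ∑ γ, (starRingEnd ℂ) (L.structureFn he α β γ u.proj) • L.secZbar he γ u ∧
      L.prolongBracket (L.secZbar he α) (secVbar he β) u = 0 ∧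
      L.prolongBracket (secVbar he α) (secVbar he β) u = 0 ∧
      L.prolongBracket (L.secZbar he α) (L.secZ he β) u = 0 ∧
      L.prolongBracket (L.secZbar he α) (secV he β) u = 0 ∧
      L.prolongBracket (secVbar he α) (secV he β) u = 0 ∧
      -- the same brackets in the opposite order
      L.prolongBracket (secV he α) (L.secZ he β) u = 0 ∧
      L.prolongBracket (secVbar he α) (L.secZ he β) u = 0 ∧
      L.prolongBracket (secV he α) (L.secZbar he β) u = 0 ∧
      L.prolongBracket (secVbar he α) (L.secZbar he β) u = 0 := by
  have hZ := L.isHolSectionAt_secZ hφ he hu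
  have hV := isHolSectionAt_secV hφ he hu
  have hZV := L.prolongBracket_secZ_secV hφ he hu
  have hVV := L.prolongBracket_secV_secV hφ he hu
  have hVZ := fun α β => HolLieAlgebroid.prolongBracket_eq_zero_symm (hZV β α)
  refine ⟨⟨L.linearIndependent_naturalFrame hφ he hu, L.span_naturalFrame hφ he hu⟩,
    fun α β => ⟨L.prolongBracket_secZ_secZ hφ he hu α β, hZV α β, hVV α β,
      L.prolongBracket_conj_right (hZ α) (hZ β), L.prolongBracket_conj_right (hZ α) (hV β),
      L.prolongBracket_conj_right (hV α) (hV β), L.prolongBracket_conj_conj (hZ α) (hZ β),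
      L.prolongBracket_secZbar_secZbar hφ he hu α β,
      L.prolongBracket_conj_conj_eq_zero (hZ α) (hV β) (hZV α β),
      L.prolongBracket_conj_conj_eq_zero (hV α) (hV β) (hVV α β),
      L.prolongBracket_conj_left (hZ α) (hZ β), L.prolongBracket_conj_left (hZ α) (hV β),
      L.prolongBracket_conj_left (hV α) (hV β), hVZ α β,
      L.prolongBracket_conj_left (hV α) (hZ β), L.prolongBracket_conj_right (hV α) (hZ β),
      L.prolongBracket_conj_conj_eq_zero (hV α) (hZ β) (hVZ α β)⟩⟩
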